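/- Let $\mathbf{NSym}=\mathbb Z\langle \mathbf h_1,\mathbf h_2,\dots\rangle$ be the free associative ring on $\mathbf h_k$ ($k\ge 1$), with $\mathbf h_0:=1$, embedded in the ring of noncommutative formal power series in $\mathbf x_i$ ($i\in\mathbb Z$) by $\mathbf h_k=\sum_{i_1\le\cdots\le i_k}\mathbf x_{i_1}\cdots\mathbf x_{i_k}$, and with the coproduct $\Delta$ that is the ring homomorphism satisfying $\Delta\mathbf h_k=\sum_{0\le i\le k}\mathbf h_i\otimes\mathbf h_{k-i}$. Compositions are finite (possibly empty) sequences $\alpha=(\alpha_1,\dots,\alpha_\ell)$ of positive integers, $\ell(\alpha)=\ell$, $|\alpha|=\sum_i\alpha_i$, $D(\alpha)=\{\alpha_1,\alpha_1+\alpha_2,\dots,\alpha_1+\cdots+\alpha_{\ell-1}\}$, and $\mathbf h_\alpha=\mathbf h_{\alpha_1}\cdots\mathbf h_{\alpha_\ell}$. The noncommutative ribbon Schur function is $\mathbf s_\alpha=\sum_{\beta}(-1)^{\ell(\alpha)-\ell(\beta)}\mathbf h_\beta$, summed over the compositions $\beta$ of $|\alpha|$ with $D(\beta)\subseteq D(\alpha)$.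 For a composition $\beta$ of $n$, let $F_\beta=\sum x_{i_1}\cdots x_{i_n}$, summed over $1\le i_1\le\cdots\le i_n$ with $i_j<i_{j+1}$ whenever $j\in D(\beta)$, be the fundamental quasisymmetric function, regarded as a linear functional on $\mathbf{NSym}$ by the pairing for which the monomial quasisymmetric functions $M_\alpha=\sum_{i_1<\cdots<i_\ell}x_{i_1}^{\alpha_1}\cdots x_{i_\ell}^{\alpha_\ell}$ and the elements $\mathbf h_\alpha$ are dual bases. For $a\in\mathbf{NSym}$ with $\Delta a=\sum a_1\otimes a_2$ put $a/f:=\sum a_1f(a_2)$ and $f\backslash a:=\sum f(a_1)a_2$, and let $\mathbf s_{\alpha/\beta}:=\mathbf s_\alpha/F_\beta$ and $\mathbf s_{\beta\backslash\alpha}:=F_\beta\backslash\mathbf s_\alpha$. Identify $\alpha$ with the ribbon diagram whose rows have lengths $\alpha_1,\dots,\alpha_\ell$ from bottom to top, the first box of each row lying directly above the last box of the row below it. A generalized ribbon $\gamma=\gamma^1\oplus\cdots\oplus\gamma^k$ is a skew diagram whose connected components are the ribbons $\gamma^1,\dots,\gamma^k$, each strictly northeast of the preceding one. Let $\mathbf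 s_\gamma$ be the sum of $\mathbf x_{w_1}\cdots\mathbf x_{w_m}$ over all fillings of $\gamma$ by integers that weakly increase from left to right in rows and strictly increase from top to bottom in columns, where $w_1\cdots w_m$ lists the entries row by row from the bottom row to the top row, left to right in each row. Let $[\gamma]$ be the set of compositions obtained by joining each successive pair of components either by $(\mu_1,\dots,\mu_p)\cdot(\nu_1,\dots,\nu_q)=(\mu_1,\dots,\mu_p,\nu_1,\dots,\nu_q)$ or by $(\mu_1,\dots,\mu_p)\rhd(\nu_1,\dots,\nu_q)=(\mu_1,\dots,\mu_{p-1},\mu_p+\nu_1,\nu_2,\dots,\nu_q)$; for the empty diagram, $[\emptyset]=\{\emptyset\}$. A decomposition $\alpha=\gamma\sqcup\delta$ is a filling of the boxes of the ribbon $\alpha$ by the two symbols $\gamma<\delta$ that weakly increases from left to right in rows and from top to bottom in columns; the boxes carrying each symbol form generalized ribbons, again denoted $\gamma$ and $\delta$. Then for all compositions $\alpha,\beta$ one has $\mathbf s_{\alpha/\beta}=\mathbf s_{\beta\backslash\alpha}$, and $$\mathbf s_{\alpha/\beta}=\sum_{\substack{\alpha=\gamma\sqcup\delta\\ \beta\in[\delta]}}\mathbf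 s_\gamma=\sum_{\substack{\alpha=\gamma\sqcup\delta\\ \gamma'\in[\gamma],\ \beta\in[\delta]}}\mathbf s_{\gamma'},\qquad \mathbf s_{\beta\backslash\alpha}=\sum_{\substack{\alpha=\gamma\sqcup\delta\\ \beta\in[\gamma]}}\mathbf s_\delta=\sum_{\substack{\alpha=\gamma\sqcup\delta\\ \beta\in[\gamma],\ \delta'\in[\delta]}}\mathbf s_{\delta'}.$$ -/

import Mathlib

open scoped TensorProduct

namespace NCSF

/-! ### Noncommutative formal power series in the variables `x_i`, `i ∈ ℤ` -/

/-- Noncommutative formal power series with integer coefficients in the variables `x_i`, `i ∈ ℤ`: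
the value at a word `w = [w₁, …, wₙ]` is the coefficient of `x_{w₁} ⋯ x_{wₙ}`. -/
def NCSeries : Type := List ℤ → ℤ

namespace NCSeries

instance : AddCommGroup NCSeries := inferInstanceAs (AddCommGroup (List ℤ → ℤ))

/-- The product of series: the coefficient of `w` is summed over all ways to cut `w` in two. -/
instance : Mul NCSeries :=
  ⟨fun f g w => ∑ i ∈ Finset.range (w.length + 1), f (w.take i) * g (w.drop i)⟩

instance : One NCSeries := ⟨fun w => if w = [] then 1 else 0⟩

theorem mul_apply (f g : NCSeries) (w : List ℤ) :
    (f * g) w = ∑ i ∈ Finset.range (w.length + 1), f (w.take i) * g (w.drop i) := rfl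

theorem one_apply (w : List ℤ) : (1 : NCSeries) w = if w = [] then 1 else 0 := rfl

theorem add_apply (f g : NCSeries) (w : List ℤ) : (f + g) w = f w + g w := rfl

theorem zero_apply (w : List ℤ) : (0 : NCSeries) w = 0 := rfl

theorem one_mul' (f : NCSeries) : 1 * f = f := by
  funext w
  rw [mul_apply, Finset.sum_eq_single 0]
  · simp [one_apply]
  · intro i hi h0
    have : w.take i ≠ [] := by
      intro h
      rw [List.take_eq_nil_iff] at h
      rcases h with h | h
      · exact h0 h
      · subst h; simp at hi; exact h0 hi
    simp [one_apply, this]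
  · simp

theorem mul_one' (f : NCSeries) : f * 1 = f := by
  funext w
  rw [mul_apply, Finset.sum_eq_single w.length]
  · simp [one_apply]
  · intro i hi h0
    have : w.drop i ≠ [] := by
      intro h
      rw [List.drop_eq_nil_iff] at h
      simp at hi; omega
    simp [one_apply, this]
  · simp

theorem mul_assoc' (f g k : NCSeries) : f * g * k = f * (g * k) := by
  funext w
  simp only [mul_apply, Finset.sum_mul, Finset.mul_sum]
  rw [Finset.sum_sigma', Finset.sum_sigma']
  refine Finset.sum_bij' (fun p _ => ⟨p.2, p.1 - p.2⟩) (fun p _ => ⟨p.1 + p.2, p.1⟩)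
    ?_ ?_ ?_ ?_ ?_
  · rintro ⟨i, j⟩ h; simp at h ⊢; omega
  · rintro ⟨i, j⟩ h; simp at h ⊢; omega
  · rintro ⟨i, j⟩ h; simp at h ⊢; omega
  · rintro ⟨i, j⟩ h; simp at h ⊢
  · rintro ⟨i, j⟩ h
    simp only [Finset.mem_sigma, Finset.mem_range, List.length_take] at h
    have h1 : j ≤ i := by omega
    simp only [List.take_take, List.drop_drop, List.drop_take, mul_assoc]
    rw [min_eq_left h1, Nat.add_sub_cancel' h1]

instance : Ring NCSeries where
  __ := (inferInstance : AddCommGroup NCSeries)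
  mul_assoc := mul_assoc'
  one_mul := one_mul'
  mul_one := mul_one'
  left_distrib f g k := by
    funext w; simp [mul_apply, add_apply, mul_add, Finset.sum_add_distrib]
  right_distrib f g k := by
    funext w; simp [mul_apply, add_apply, add_mul, Finset.sum_add_distrib]
  zero_mul f := by funext w; simp [mul_apply, zero_apply]
  mul_zero f := by funext w; simp [mul_apply, zero_apply]

end NCSeries

/-! ### The Hopf algebra `NSym` -/

/-- `NSym` is the free associative ring `ℤ⟨h₁, h₂, …⟩`, that is, the monoid ring of the free monoid on
the generators `h_k`, `k ≥ 1`. (Its coproduct is `comul` below, which is not the coproduct for which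
the elements of the monoid are grouplike.) -/
abbrev NSym : Type := MonoidAlgebra ℤ (FreeMonoid ℕ+)

/-- The element `h_k` of `NSym`, with `h₀ = 1`. -/
noncomputable def h (k : ℕ) : NSym :=
  if hk : 0 < k then MonoidAlgebra.of ℤ (FreeMonoid ℕ+) (FreeMonoid.of ⟨k, hk⟩) else 1

/-- The series `∑_{i₁ ≤ ⋯ ≤ i_k} x_{i₁} ⋯ x_{i_k}`. -/
noncomputable def hSeries (k : ℕ) : NCSeries := by
  classical exact fun w => if w.length = k ∧ w.Pairwise (· ≤ ·) then 1 else 0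

/-- The realization of `NSym` by noncommutative series, `h_k ↦ ∑_{i₁ ≤ ⋯ ≤ i_k} x_{i₁} ⋯ x_{i_k}`.
It is injective (`toSeries_injective` below), so that it identifies `NSym` with a ring of series. -/
noncomputable def toSeries : NSym →ₐ[ℤ] NCSeries :=
  MonoidAlgebra.lift ℤ NCSeries (FreeMonoid ℕ+) (FreeMonoid.lift fun k : ℕ+ => hSeries k)

/-- The coproduct of `NSym`: the ring homomorphism with `Δ h_k = ∑_{0 ≤ i ≤ k} h_i ⊗ h_{k-i}`. -/
noncomputable def comul : NSym →ₐ[ℤ] NSym ⊗[ℤ] NSym :=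
  MonoidAlgebra.lift ℤ (NSym ⊗[ℤ] NSym) (FreeMonoid ℕ+) (FreeMonoid.lift fun k : ℕ+ =>
    ∑ i ∈ Finset.range ((k : ℕ) + 1), h i ⊗ₜ[ℤ] h ((k : ℕ) - i))

/-! ### Compositions, ribbon Schur functions -/

/-- The descent set `{α₁, α₁ + α₂, …, α₁ + ⋯ + α_{ℓ-1}}` of a composition. -/
def descentSet {n : ℕ} (α : Composition n) : Finset ℕ :=
  (Finset.Ioo 0 α.length).image α.sizeUpTo

/-- `h_α = h_{α₁} ⋯ h_{α_ℓ}`. -/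
noncomputable def hComp {n : ℕ} (α : Composition n) : NSym := (α.blocks.map h).prod

/-- The noncommutative ribbon Schur function `s_α` of a composition: the sum of
`(-1)^{ℓ(α) - ℓ(β)} h_β` over all compositions `β` of the same size with `D(β) ⊆ D(α)`. -/
noncomputable def ribbonSchur {n : ℕ} (α : Composition n) : NSym :=
  ∑ β : Composition n with descentSet β ⊆ descentSet α,
    (-1 : ℤ) ^ (α.length - β.length) • hComp β

/-! ### Quasisymmetric functions and the pairing with `NSym`

The commutative variables `x₁ < x₂ < ⋯` are indexed by `ℕ` (starting from `0`). -/

/-- The monomial quasisymmetric function `M_α = ∑_{i₁ < ⋯ < i_ℓ} x_{i₁}^{α₁} ⋯ x_{i_ℓ}^{α_ℓ}`. -/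
noncomputable def monomialQSym {n : ℕ} (α : Composition n) : MvPowerSeries ℕ ℤ := fun m =>
  (Nat.card {i : Fin α.length → ℕ //
    StrictMono i ∧ ∑ k, Finsupp.single (i k) (α.blocksFun k) = m} : ℤ)

/-- The fundamental quasisymmetric function `F_α`: the sum of `x_{i₁} ⋯ x_{iₙ}` over all
`i₁ ≤ ⋯ ≤ iₙ` such that `i_j < i_{j+1}` for all `j ∈ D(α)`. (The `j`-th index is `i ⟨j - 1, _⟩`.) -/
noncomputable def fundamentalQSym {n : ℕ} (α : Composition n) : MvPowerSeries ℕ ℤ := fun m =>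
  (Nat.card {i : Fin n → ℕ //
    (Monotone i ∧ ∀ j k : Fin n, (k : ℕ) = j + 1 → (k : ℕ) ∈ descentSet α → i j < i k) ∧
      ∑ k, Finsupp.single (i k) 1 = m} : ℤ)

/-- The monomial `x₁^{a₁} ⋯ x_ℓ^{a_ℓ}` as an exponent vector. -/
def packedExponent (a : FreeMonoid ℕ+) : ℕ →₀ ℕ :=
  (a.toList.map fun k : ℕ+ => (k : ℕ)).toFinsupp

/-- The pairing of a quasisymmetric function `f` with `NSym`, as a linear functional on `NSym`: on
the basis element `h_{a₁} ⋯ h_{a_ℓ}` it takes the coefficient in `f` of `x₁^{a₁} ⋯ x_ℓ^{a_ℓ}`, which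
is the coefficient of `M_a` in the expansion of `f`. Thus the bases `M` and `h` are dual
(`pairing_monomialQSym_hComp` below). -/
noncomputable def pairing (f : MvPowerSeries ℕ ℤ) : NSym →ₗ[ℤ] ℤ :=
  (MonoidAlgebra.basis (FreeMonoid ℕ+) ℤ).constr ℤ fun a =>
    MvPowerSeries.coeff (packedExponent a) f

/-- The skewing operator `a ↦ a / f = ∑ a₁ f(a₂)`, where `Δ a = ∑ a₁ ⊗ a₂`. -/
noncomputable def skewRight (a : NSym) (f : MvPowerSeries ℕ ℤ) : NSym :=
  TensorProduct.rid ℤ NSym ((pairing f).lTensor NSym (comul a))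

/-- The skewing operator `a ↦ f \ a = ∑ f(a₁) a₂`, where `Δ a = ∑ a₁ ⊗ a₂`. -/
noncomputable def skewLeft (f : MvPowerSeries ℕ ℤ) (a : NSym) : NSym :=
  TensorProduct.lid ℤ NSym ((pairing f).rTensor NSym (comul a))

/-! ### Diagrams -/

/-- A box, given by its row (numbered from bottom to top) and its column (numbered from left to
right). The lexicographic order is the reading order: rows from bottom to top, and from left to
right within each row. -/
abbrev Box : Type := ℕ ×ₗ ℕ

namespace Box

/-- The row of a box. -/
def row (p : Box) : ℕ := (ofLex p).1

/-- The column of a box. -/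
def col (p : Box) : ℕ := (ofLex p).2

/-- `q` is the right neighbour of `p`. -/
def IsRightOf (q p : Box) : Prop := q.row = p.row ∧ q.col = p.col + 1

/-- `q` is the upper neighbour of `p`. -/
def IsAbove (q p : Box) : Prop := q.col = p.col ∧ q.row = p.row + 1

instance (q p : Box) : Decidable (q.IsRightOf p) := by unfold IsRightOf; infer_instance

instance (q p : Box) : Decidable (q.IsAbove p) := by unfold IsAbove; infer_instance

end Box

/-- The boxes, in reading order, of the ribbon with row lengths `l` (from bottom to top) whose first
box is in row `r` and column `c`: each row starts above the last box of the preceding row. -/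
def ribbonFrom : ℕ → ℕ → List ℕ → List Box
  | _, _, [] => []
  | r, c, a :: l => (List.range a).map (fun j => toLex (r, c + j)) ++ ribbonFrom (r + 1) (c + a - 1) l

/-- The ribbon diagram of a composition. -/
def ribbon {n : ℕ} (α : Composition n) : Finset Box := (ribbonFrom 0 0 α.blocks).toFinset

/-- A filling of a diagram is semistandard if it weakly increases from left to right in each row and
strictly increases from top to bottom in each column. -/
def IsSemistandard {B : Finset Box} (τ : B → ℤ) : Prop :=
  ∀ p q : B,
    (p.1.row = q.1.row → p.1.col < q.1.col → τ p ≤ τ q) ∧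
    (p.1.col = q.1.col → q.1.row < p.1.row → τ p < τ q)

/-- The entries of a filling, in reading order. -/
def readingWord {B : Finset Box} (τ : B → ℤ) : List ℤ :=
  List.ofFn fun i : Fin B.card => τ (B.orderIsoOfFin rfl i)

/-- The noncommutative Schur function of a diagram: the sum of `x_τ = x_{w₁} ⋯ x_{wₙ}` over all
semistandard fillings `τ`, where `w₁ ⋯ wₙ` is the reading word of `τ`. -/
noncomputable def diagramSchur (B : Finset Box) : NCSeries := fun w =>
  (Nat.card {τ : B → ℤ // IsSemistandard τ ∧ readingWord τ = w} : ℤ)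

/-- The connected components of a generalized ribbon, from southwest to northeast, each one given by
the list of its row lengths from bottom to top. (In a generalized ribbon, two successive boxes in the
reading order are in the same component exactly if they are neighbours.) -/
def components (B : Finset Box) : List (List ℕ) :=
  (B.sort.splitBy fun p q => decide (q.IsRightOf p ∨ q.IsAbove p)).map fun C =>
    (C.splitBy fun p q => decide (q.IsRightOf p)).map List.length

/-- `α ▹ β = (α₁, …, α_{ℓ-1}, α_ℓ + β₁, β₂, …, β_k)`. -/
def nearConcat : List ℕ → List ℕ → List ℕ
  | [], b => b
  | [x], [] => [x]
  | [x], y :: b => (x + y) :: b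
  | x :: x' :: a, b => x :: nearConcat (x' :: a) b

/-- The set `[α¹ ⊕ ⋯ ⊕ αᵏ]`: `[α¹] = {α¹}`, and `[α¹ ⊕ ⋯ ⊕ αᵏ]` consists of all `β · αᵏ` and
`β ▹ αᵏ` with `β ∈ [α¹ ⊕ ⋯ ⊕ αᵏ⁻¹]`. For the empty generalized ribbon it is `{∅}`. -/
def bracketList : List (List ℕ) → Finset (List ℕ)
  | [] => {[]}
  | a :: L => L.foldl (fun S c => S.image (· ++ c) ∪ S.image (nearConcat · c)) {a}

/-- The set `[B]` of compositions of `n`, for a generalized ribbon `B`. (It is empty unless `B` has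
`n` boxes.) -/
def bracket (n : ℕ) (B : Finset Box) : Finset (Composition n) :=
  {β | β.blocks ∈ bracketList (components B)}

/-- All decompositions `α = γ ⊔ δ`, as pairs `(γ, δ)` of diagrams: the boxes of the ribbon `α` are
filled with the symbols `γ < δ`, weakly increasing from left to right in each row and from top to
bottom in each column. -/
def decompositions {n : ℕ} (α : Composition n) : Finset (Finset Box × Finset Box) :=
  {B ∈ (ribbon α).powerset | ∀ p ∈ ribbon α, ∀ q ∈ B,
      (p.row = q.row ∧ p.col < q.col) ∨ (p.col = q.col ∧ q.row < p.row) → p ∈ B}.image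
    fun B => (B, ribbon α \ B)

/-! ### The definitions fit together -/

/-- The basis elements of `NSym` are the products `h_{a₁} ⋯ h_{a_ℓ}`. -/
theorem single_eq_prod_h (a : FreeMonoid ℕ+) :
    (MonoidAlgebra.single a 1 : NSym) = (a.toList.map fun k : ℕ+ => h k).prod := by
  induction a using FreeMonoid.inductionOn' with
  | one => rfl
  | of_mul k a ih =>
    have h1 : (MonoidAlgebra.single (FreeMonoid.of k * a) 1 : NSym) =
        MonoidAlgebra.single (FreeMonoid.of k) 1 * MonoidAlgebra.single a 1 := by
      rw [MonoidAlgebra.single_mul_single, mul_one]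
    rw [h1, ih, FreeMonoid.toList_mul, FreeMonoid.toList_of, List.map_append, List.prod_append]
    simp [h]
    rfl

/-- The word `w` is cut into weakly increasing words of lengths `a₁, …, a_ℓ`. -/
def CutsInto : List ℕ+ → List ℤ → Prop
  | [], w => w = []
  | k :: a, w => (k : ℕ) ≤ w.length ∧ (w.take k).Pairwise (· ≤ ·) ∧ CutsInto a (w.drop k)

theorem hSeries_mul_apply (k : ℕ) (g : NCSeries) (w : List ℤ)
    [Decidable (k ≤ w.length ∧ (w.take k).Pairwise (· ≤ ·))] :
    (hSeries k * g) w =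
      if k ≤ w.length ∧ (w.take k).Pairwise (· ≤ ·) then g (w.drop k) else 0 := by
  classical
  rw [NCSeries.mul_apply]
  split_ifs with hk
  · rw [Finset.sum_eq_single k]
    · simp [hSeries, hk.1, hk.2]
    · intro i hi hik
      simp only [Finset.mem_range] at hi
      have : (w.take i).length ≠ k := by rw [List.length_take]; omega
      simp [hSeries, -List.length_take, this]
    · intro h'; simp at h'; omega
  · apply Finset.sum_eq_zero
    intro i hi
    simp only [Finset.mem_range] at hi
    have : ¬ ((w.take i).length = k ∧ (w.take i).Pairwise (· ≤ ·)) := by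
      rintro ⟨h1, h2⟩
      rw [List.length_take] at h1
      have : i = k := by omega
      subst this
      exact hk ⟨by omega, h2⟩
    simp only [hSeries, if_neg this, zero_mul]

theorem toSeries_single (a : List ℕ+) (w : List ℤ) [Decidable (CutsInto a w)] :
    toSeries (MonoidAlgebra.single (FreeMonoid.ofList a) 1) w = if CutsInto a w then 1 else 0 := by
  classical
  induction a generalizing w with
  | nil =>
    simp only [toSeries, MonoidAlgebra.lift_single, one_smul, FreeMonoid.ofList_nil,
      map_one, NCSeries.one_apply]
    exact if_congr Iff.rfl rfl rfl
  | cons k a ih =>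
    have h2 : toSeries (MonoidAlgebra.single (FreeMonoid.ofList (k :: a)) 1) =
        hSeries k * toSeries (MonoidAlgebra.single (FreeMonoid.ofList a) 1) := by
      simp [toSeries, MonoidAlgebra.lift_single, FreeMonoid.ofList_cons]
    rw [h2, hSeries_mul_apply]
    simp only [ih]
    by_cases hc : CutsInto (k :: a) w
    · rw [if_pos hc, if_pos ⟨hc.1, hc.2.1⟩, if_pos hc.2.2]
    · rw [if_neg hc]
      by_cases h3 : (k : ℕ) ≤ w.length ∧ (w.take k).Pairwise (· ≤ ·)
      · rw [if_pos h3, if_neg fun h4 => hc ⟨h3.1, h3.2, h4⟩]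
      · rw [if_neg h3]

/-- A word which is weakly increasing precisely on blocks of lengths `a₁, …, a_ℓ`. -/
def blockWord : List ℕ+ → List ℤ
  | [] => []
  | k :: a => List.replicate k ((a.length : ℤ) + 1) ++ blockWord a

theorem cutsInto_blockWord (a : List ℕ+) : CutsInto a (blockWord a) := by
  induction a with
  | nil => rfl
  | cons k a ih =>
    refine ⟨by simp [blockWord], ?_, ?_⟩
    · simp [blockWord, List.pairwise_replicate]
    · simpa [blockWord] using ih

theorem length_le_of_cutsInto (a b : List ℕ+) (hab : CutsInto a (blockWord b)) :
    b.length ≤ a.length ∧ (b.length = a.length → a = b) := by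
  induction a generalizing b with
  | nil =>
    cases b with
    | nil => simp
    | cons m b =>
      have hl := congrArg List.length hab
      have := m.pos
      simp [blockWord] at hl
  | cons k a ih =>
    cases b with
    | nil =>
      have := k.pos
      have h1 := hab.1
      simp [blockWord] at h1
    | cons m b =>
      obtain ⟨h1, h2, h3⟩ := hab
      rcases lt_trichotomy k m with hkm | rfl | hkm
      · have h4 : (blockWord (m :: b)).drop k = blockWord ((m - k) :: b) := by
          have h5 : ((m - k : ℕ+) : ℕ) = m - k := by rw [PNat.sub_coe, if_pos hkm]
          have h6 : (k : ℕ) ≤ m := hkm.le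
          simp [blockWord, List.drop_append, h5, Nat.sub_eq_zero_of_le h6]
        rw [h4] at h3
        have := (ih _ h3).1
        simp only [List.length_cons] at this ⊢
        exact ⟨by omega, fun h => by omega⟩
      · have h4 : (blockWord (k :: b)).drop k = blockWord b := by simp [blockWord]
        rw [h4] at h3
        have := ih _ h3
        simp only [List.length_cons, Nat.add_le_add_iff_right, Nat.add_right_cancel_iff]
        exact ⟨this.1, fun h => by rw [this.2 h]⟩
      · exfalso
        have h6 : (m : ℕ) < k := hkm
        cases b with
        | nil =>
          simp only [blockWord, List.append_nil, List.length_replicate] at h1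
          omega
        | cons m' b =>
          have h7 : (blockWord (m :: m' :: b)).take k =
              List.replicate m ((b.length : ℤ) + 1 + 1) ++ (blockWord (m' :: b)).take (k - m) := by
            rw [blockWord, List.take_append, List.take_replicate, List.length_replicate,
              min_eq_right h6.le]
            simp
          rw [h7, List.pairwise_append] at h2
          have h8 := h2.2.2 ((b.length : ℤ) + 1 + 1) (by simp [m.pos.ne'])
            ((b.length : ℤ) + 1) (by
              obtain ⟨p, hp⟩ : ∃ p, (k : ℕ) - m = p + 1 := ⟨k - m - 1, by omega⟩
              obtain ⟨q, hq⟩ : ∃ q, (m' : ℕ) = q + 1 := ⟨m' - 1, by have := m'.pos; omega⟩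
              rw [blockWord, hp, hq, List.replicate_succ, List.cons_append, List.take_succ_cons]
              exact List.mem_cons_self)
          omega

/-- Sending `h_k` to its series is an embedding of `NSym`. -/
theorem toSeries_injective : Function.Injective toSeries := by
  classical
  rw [injective_iff_map_eq_zero]
  intro f hf
  by_contra hne
  have hsupp : f.coeff.support.Nonempty := by
    rw [Finsupp.support_nonempty_iff]
    simpa using hne
  obtain ⟨b, hb, hmax⟩ := Finset.exists_max_image _ (fun a : FreeMonoid ℕ+ => a.toList.length) hsupp
  have h1 : ∀ w, toSeries f w = ∑ a ∈ f.coeff.support,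
      f.coeff a * (if CutsInto a.toList w then 1 else 0) := by
    intro w
    have h2 : f = ∑ a ∈ f.coeff.support, f.coeff a • (MonoidAlgebra.single a 1 : NSym) := by
      conv_lhs => rw [← MonoidAlgebra.sum_coeff_single f]
      simp [Finsupp.sum]
    have h3 : ∀ (s : Finset (FreeMonoid ℕ+)) (F : FreeMonoid ℕ+ → NCSeries),
        (∑ a ∈ s, F a) w = ∑ a ∈ s, F a w := by
      intro s F
      exact Finset.sum_apply w s F
    have h4 : ∀ (c : ℤ) (F : NCSeries), (c • F) w = c * F w := by
      intro c F
      exact Pi.smul_apply (M := fun _ : List ℤ => ℤ) c F w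
    conv_lhs => rw [h2]
    rw [map_sum, h3]
    refine Finset.sum_congr rfl fun a _ => ?_
    rw [map_zsmul, h4]
    congr 1
    exact toSeries_single a.toList w
  have h5 := h1 (blockWord b.toList)
  rw [hf, Finset.sum_eq_single b] at h5
  · rw [if_pos (cutsInto_blockWord _), mul_one, NCSeries.zero_apply] at h5
    exact (Finsupp.mem_support_iff.mp hb) h5.symm
  · intro a ha hab
    rw [if_neg, mul_zero]
    intro hc
    have h6 := length_le_of_cutsInto _ _ hc
    exact hab (FreeMonoid.toList.injective (h6.2 (le_antisymm h6.1 (hmax a ha))))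
  · exact fun h => absurd hb h

/-- The bases `M` and `h` are dual. -/
theorem pairing_monomialQSym_hComp {m n : ℕ} (α : Composition m) (β : Composition n) :
    pairing (monomialQSym α) (hComp β) = if α.blocks = β.blocks then 1 else 0 := by
  obtain ⟨b, hb⟩ : ∃ b : List ℕ+, b.map (fun k : ℕ+ => (k : ℕ)) = β.blocks := by
    refine ⟨β.blocks.attach.map fun k => Nat.toPNat k.1 (β.blocks_pos k.2), ?_⟩
    rw [List.map_map]
    exact List.attach_map_subtype_val β.blocks
  have h1 : hComp β = MonoidAlgebra.single (FreeMonoid.ofList b) 1 := by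
    rw [single_eq_prod_h, hComp, ← hb, List.map_map]
    rfl
  have h2 : pairing (monomialQSym α) (hComp β) =
      monomialQSym α (packedExponent (FreeMonoid.ofList b)) := by
    have := (MonoidAlgebra.basis (FreeMonoid ℕ+) ℤ).constr_basis ℤ
      (fun a => MvPowerSeries.coeff (packedExponent a) (monomialQSym α)) (FreeMonoid.ofList b)
    rw [h1]
    exact (congrArg _ (MonoidAlgebra.basis_apply ..).symm).trans this
  rw [h2]
  have h3 : ∀ x, packedExponent (FreeMonoid.ofList b) x = β.blocks.getD x 0 := by
    intro x
    simp [packedExponent, hb]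
  have key : ∀ i : Fin α.length → ℕ, StrictMono i →
      ((∑ k, Finsupp.single (i k) (α.blocksFun k) = packedExponent (FreeMonoid.ofList b)) ↔
        α.blocks = β.blocks ∧ i = fun k : Fin α.length => (k : ℕ)) := by
    intro i hi
    have hsum : ∀ k, (∑ k, Finsupp.single (i k) (α.blocksFun k)) (i k) = α.blocksFun k := by
      intro k
      rw [Finsupp.finsetSum_apply, Finset.sum_eq_single k]
      · simp
      · intro k' _ hk
        exact Finsupp.single_eq_of_ne fun h => hk (hi.injective h).symm
      · simp
    have hsum0 : ∀ x, x ∉ Set.range i →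
        (∑ k, Finsupp.single (i k) (α.blocksFun k)) x = 0 := by
      intro x hx
      rw [Finsupp.finsetSum_apply]
      exact Finset.sum_eq_zero fun k _ => Finsupp.single_eq_of_ne fun h => hx ⟨k, h.symm⟩
    have hpos : ∀ k, 0 < α.blocksFun k := fun k => α.blocks_pos' _ k.2
    have hget : ∀ x (hx : x < α.blocks.length), α.blocksFun ⟨x, hx⟩ = α.blocks[x] :=
      fun x hx => rfl
    constructor
    · intro heq
      have hrange : Set.range i = {x | x < β.blocks.length} := by
        ext x
        constructor
        · rintro ⟨k, rfl⟩
          have h4 := hsum k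
          rw [heq, h3] at h4
          by_contra hlt
          rw [Set.mem_ofPred_eq, not_lt] at hlt
          rw [List.getD_eq_default _ _ hlt] at h4
          exact (hpos k).ne h4
        · intro hx
          by_contra hn
          have h4 := hsum0 x hn
          rw [heq, h3, List.getD_eq_getElem _ _ hx] at h4
          exact (β.blocks_pos (List.getElem_mem hx)).ne' h4
      have hlen : α.blocks.length = β.blocks.length := by
        have h5 := congrArg Set.ncard hrange
        rw [← Set.image_univ, Set.ncard_image_of_injective _ hi.injective, Set.ncard_univ] at h5
        have h6 : {x | x < β.blocks.length} = (Finset.range β.blocks.length : Set ℕ) := by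
          ext; simp
        rw [h6, Set.ncard_coe_finset] at h5
        simpa [Composition.length] using h5
      have hival : i = fun k : Fin α.length => (k : ℕ) := by
        refine (StrictMono.range_inj hi (fun a b h => h)).mp ?_
        rw [hrange, ← hlen]
        ext x
        exact ⟨fun hx => ⟨⟨x, hx⟩, rfl⟩, fun ⟨k, hk⟩ => hk ▸ k.2⟩
      refine ⟨List.ext_getElem hlen fun x hx hx' => ?_, hival⟩
      have h4 := hsum ⟨x, hx⟩
      rw [heq, h3, hival, List.getD_eq_getElem _ _ hx'] at h4
      exact h4.symm
    · rintro ⟨hbl, rfl⟩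
      ext x
      rw [h3, ← hbl]
      by_cases hx : x < α.blocks.length
      · rw [List.getD_eq_getElem _ _ hx]
        exact hsum ⟨x, hx⟩
      · rw [List.getD_eq_default _ _ (not_lt.mp hx)]
        exact hsum0 x fun ⟨k, hk⟩ => hx (hk ▸ k.2)
  rw [monomialQSym]
  split_ifs with hbl
  · have : ∃! i : Fin α.length → ℕ, StrictMono i ∧
        ∑ k, Finsupp.single (i k) (α.blocksFun k) = packedExponent (FreeMonoid.ofList b) := by
      refine ⟨fun k => (k : ℕ), ⟨fun a b h => h, (key _ fun a b h => h).mpr ⟨hbl, rfl⟩⟩, ?_⟩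
      rintro i ⟨hi, h4⟩
      exact ((key i hi).mp h4).2
    obtain ⟨i, hi, hu⟩ := this
    have : Unique {i : Fin α.length → ℕ // StrictMono i ∧
        ∑ k, Finsupp.single (i k) (α.blocksFun k) = packedExponent (FreeMonoid.ofList b)} :=
      ⟨⟨⟨i, hi⟩⟩, fun j => Subtype.ext (hu j.1 j.2)⟩
    rw [Nat.card_unique, Nat.cast_one]
  · have : IsEmpty {i : Fin α.length → ℕ // StrictMono i ∧
        ∑ k, Finsupp.single (i k) (α.blocksFun k) = packedExponent (FreeMonoid.ofList b)} :=
      ⟨fun j => hbl ((key j.1 j.2.1).mp j.2.2).1⟩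
    rw [Nat.card_of_isEmpty, Nat.cast_zero]

end NCSF

namespace NCSF

/-! ### Patterns of steps -/

/-! Everything is encoded by local data along the reading order. A composition becomes a boolean
word marking the boxes that start a row, and a diagram becomes a pattern whose letters demand a step
to the right, demand a step upwards, or leave the step free when successive boxes are not
neighbours. The Schur function `patternSchur` of a pattern obeys the relation "up = free − right",
and the 0/1 indicator of a pattern fitting a fixed word obeys the same relation. So a functional
that is such an indicator on the products of the `h k` is the indicator on all patterns
(`map_patternSchur`).

This is used twice. Taking the coefficient of a word `w` gives `toSeries_patternSchur`: the pattern
must fit the descents of `w`. Pairing with a fundamental quasisymmetric function gives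
`pairing_fundamentalQSym_patternSchur`: the pattern must fit the word of `β`. By `mem_bracket_iff`,
fitting the pattern of a generalized ribbon is the same as lying in its bracket. The first use also
shows that the Schur function of a diagram is the sum of ribbon Schur functions over the bracket
(`sum_bracket_ribbonSchur`). It further agrees with the generating function of semistandard fillings
when the diagram is a staircase (`diagramSchur_eq_toSeries`).

What remains is the coproduct: `Δ s_α` is the sum of `s_γ ⊗ s_δ` over all decompositions
(`comul_ribbonSchur`). A row of boxes is cut by `Δ` into an initial part `γ` and a final part `δ`.
Running along the ribbon box by box, the terms in which `γ` turns into `δ` on an upward step cancel,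
which leaves exactly the admissible changes of symbol (`comul_patternSchurFrom`, `sum_fillingTerm`).
Applying the functional of `F_β` to either tensor factor selects the decompositions with `β` in the
corresponding bracket. Cocommutativity identifies the two skewings. -/

/-- A composition as a word of booleans, one for each box of its ribbon: the letter `true` marks the
boxes which start a new row. -/
def rowStarts (l : List ℕ) : List Bool := l.flatMap fun a => true :: List.replicate (a - 1) false

theorem rowStarts_cons (a : ℕ) (l : List ℕ) :
    rowStarts (a :: l) = true :: (List.replicate (a - 1) false ++ rowStarts l) := by
  simp [rowStarts]

theorem length_rowStarts (l : List ℕ) (hl : ∀ a ∈ l, 0 < a) : (rowStarts l).length = l.sum := by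
  induction l with
  | nil => rfl
  | cons a l ih =>
    have := hl a (by simp)
    have := ih fun b hb => hl b (by simp [hb])
    simp [rowStarts_cons, this]; omega

theorem count_rowStarts (l : List ℕ) : (rowStarts l).count true = l.length := by
  induction l with
  | nil => rfl
  | cons a l ih => simp [rowStarts_cons, ih, List.count_replicate]

/-- The row lengths of a ribbon whose first row already has `k` boxes. -/
def rowLengthsFrom : ℕ → List Bool → List ℕ
  | k, [] => [k]
  | k, false :: v => rowLengthsFrom (k + 1) v
  | k, true :: v => k :: rowLengthsFrom 1 v

/-- One half of the inverse correspondence between lists of positive row lengths and boolean words.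
The accumulator `k` counts the boxes of the unfinished row, which contribute one `true` and `k - 1`
letters `false`. -/
theorem rowStarts_rowLengthsFrom (k : ℕ) (hk : 0 < k) (v : List Bool) :
    rowStarts (rowLengthsFrom k v) = true :: (List.replicate (k - 1) false ++ v) := by
  induction v generalizing k with
  | nil => simp [rowLengthsFrom, rowStarts]
  | cons x v ih =>
    cases x with
    | false =>
      obtain ⟨k, rfl⟩ : ∃ j, k = j + 1 := ⟨k - 1, by omega⟩
      rw [rowLengthsFrom, ih _ (by omega)]
      simp [List.replicate_succ']
    | true => rw [rowLengthsFrom, rowStarts_cons, ih _ one_pos]; simp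

theorem rowLengthsFrom_pos (k : ℕ) (hk : 0 < k) (v : List Bool) :
    ∀ a ∈ rowLengthsFrom k v, 0 < a := by
  induction v generalizing k with
  | nil => simpa [rowLengthsFrom] using hk
  | cons x v ih =>
    cases x with
    | false => exact ih _ (by omega)
    | true => simpa [rowLengthsFrom, hk] using ih 1 one_pos

theorem rowLengthsFrom_replicate_append (k j : ℕ) (v : List Bool) :
    rowLengthsFrom k (List.replicate j false ++ v) = rowLengthsFrom (k + j) v := by
  induction j generalizing k with
  | zero => rfl
  | succ j ih => simp only [List.replicate_succ, List.cons_append, rowLengthsFrom, ih]; congr 1; omega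

theorem rowLengthsFrom_rowStarts (a : ℕ) (l : List ℕ) (hl : ∀ b ∈ l, 0 < b) :
    rowLengthsFrom a (rowStarts l) = a :: l := by
  induction l generalizing a with
  | nil => rfl
  | cons b l ih =>
    have := hl b (by simp)
    rw [rowStarts_cons, rowLengthsFrom, rowLengthsFrom_replicate_append,
      show 1 + (b - 1) = b by omega, ih _ fun c hc => hl c (by simp [hc])]

theorem rowLengthsFrom_tail_rowStarts (a : ℕ) (l : List ℕ) (hl : ∀ b ∈ a :: l, 0 < b) :
    rowLengthsFrom 1 (rowStarts (a :: l)).tail = a :: l := by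
  have := hl a (by simp)
  rw [rowStarts_cons, List.tail_cons, rowLengthsFrom_replicate_append,
    show 1 + (a - 1) = a by omega, rowLengthsFrom_rowStarts _ _ fun b hb => hl b (by simp [hb])]

theorem rowStarts_injOn {l l' : List ℕ} (hl : ∀ a ∈ l, 0 < a) (hl' : ∀ a ∈ l', 0 < a)
    (h : rowStarts l = rowStarts l') : l = l' := by
  cases l with
  | nil =>
    cases l' with
    | nil => rfl
    | cons a l' => simp [rowStarts] at h
  | cons a l =>
    cases l' with
    | nil => simp [rowStarts] at h
    | cons b l' =>
      rw [← rowLengthsFrom_tail_rowStarts a l hl, h, rowLengthsFrom_tail_rowStarts b l' hl']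

/-- With `rowStarts_injOn` and `head?_rowStarts`, this makes compositions the same thing as boolean
words that are empty or begin with `true`. -/
theorem exists_rowStarts_eq (v : List Bool) (hv : v.head? ≠ some false) :
    ∃ l : List ℕ, (∀ a ∈ l, 0 < a) ∧ rowStarts l = v := by
  rcases v with _ | ⟨x, v⟩
  · exact ⟨[], by simp, rfl⟩
  · cases x with
    | false => simp at hv
    | true =>
      exact ⟨rowLengthsFrom 1 v, rowLengthsFrom_pos 1 one_pos v,
        by simpa using rowStarts_rowLengthsFrom 1 one_pos v⟩

theorem head?_rowStarts (l : List ℕ) : (rowStarts l).head? ≠ some false := by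
  cases l <;> simp [rowStarts]

theorem Composition.length_rowStarts_blocks {n : ℕ} (α : Composition n) :
    (rowStarts α.blocks).length = n := by
  rw [length_rowStarts _ fun a => α.blocks_pos, α.blocks_sum]

theorem exists_composition_rowStarts (v : List Bool) (hv : v.head? ≠ some false) :
    ∃ α : Composition v.length, rowStarts α.blocks = v := by
  obtain ⟨l, hl, rfl⟩ := exists_rowStarts_eq v hv
  exact ⟨⟨l, fun {i} hi => hl i hi, (length_rowStarts l hl).symm⟩, rfl⟩

/-- A pattern of steps prescribes (`some x`) or leaves free (`none`) each letter of a word of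
booleans. -/
def Fits (g : List (Option Bool)) (b : List Bool) : Prop :=
  List.Forall₂ (fun o x => o = none ∨ o = some x) g b

instance (g : List (Option Bool)) (b : List Bool) : Decidable (Fits g b) := by
  unfold Fits; infer_instance

theorem fits_cons {o : Option Bool} {x : Bool} {g : List (Option Bool)} {b : List Bool} :
    Fits (o :: g) (x :: b) ↔ (o = none ∨ o = some x) ∧ Fits g b := List.forall₂_cons

theorem fits_nil_left {b : List Bool} : Fits [] b ↔ b = [] := List.forall₂_nil_left_iff

theorem fits_nil_right {g : List (Option Bool)} : Fits g [] ↔ g = [] := List.forall₂_nil_right_iff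

theorem Fits.length_eq {g : List (Option Bool)} {b : List Bool} (h : Fits g b) :
    g.length = b.length := List.Forall₂.length_eq h

theorem fits_append {g g' : List (Option Bool)} {b : List Bool} :
    Fits (g ++ g') b ↔ ∃ c c', b = c ++ c' ∧ Fits g c ∧ Fits g' c' := by
  induction g generalizing b with
  | nil => simp [fits_nil_left]
  | cons o g ih =>
    cases b with
    | nil =>
      simp only [List.cons_append, fits_nil_right, reduceCtorEq, false_iff]
      rintro ⟨c, c', h, h1, -⟩
      rw [eq_comm, List.append_eq_nil_iff] at h
      rw [h.1, fits_nil_right] at h1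
      simp at h1
    | cons x b =>
      simp only [List.cons_append, fits_cons, ih]
      constructor
      · rintro ⟨h, c, c', rfl, h1, h2⟩
        exact ⟨x :: c, c', rfl, fits_cons.mpr ⟨h, h1⟩, h2⟩
      · rintro ⟨c, c', h, h1, h2⟩
        cases c with
        | nil => cases h1
        | cons y c =>
          simp only [List.cons_append, List.cons.injEq] at h
          obtain ⟨rfl, rfl⟩ := h
          rw [fits_cons] at h1
          exact ⟨h1.1, c, c', rfl, h1.2, h2⟩

/-- A free letter is matched either by `false` or by `true`, so indicators are additive in each
letter. This mirrors the subtraction in the definition of `patternSchurFrom`. -/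
theorem fits_append_some_true (g g' : List (Option Bool)) (b : List Bool) :
    (if Fits (g ++ none :: g') b then (1 : ℤ) else 0) -
      (if Fits (g ++ some false :: g') b then 1 else 0) =
      if Fits (g ++ some true :: g') b then 1 else 0 := by
  induction g generalizing b with
  | nil => rcases b with _ | ⟨_ | _, b⟩ <;> simp [fits_cons, fits_nil_right]
  | cons o g ih =>
    rcases b with _ | ⟨x, b⟩
    · simp [fits_nil_right]
    · by_cases ho : o = none ∨ o = some x
      · simpa [fits_cons, ho] using ih b
      · simp [fits_cons, ho]

theorem fits_map_some (b c : List Bool) : Fits (b.map some) c ↔ b = c := by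
  induction b generalizing c with
  | nil => simp [fits_nil_left, eq_comm]
  | cons x b ih => cases c <;> simp [fits_cons, fits_nil_right, ih]

/-- The pattern of `h_{a₁} ⋯ h_{a_ℓ}`: disjoint rows. -/
def rowsPattern (l : List ℕ) : List (Option Bool) :=
  l.flatMap fun a => none :: List.replicate (a - 1) (some false)

/-- The pattern of a ribbon. -/
def ribbonPattern : List Bool → List (Option Bool)
  | [] => []
  | _ :: v => none :: v.map some

/-- The only free letter of a ribbon pattern is the first one, and there both words carry `true`.
Hence a ribbon pattern fits exactly one word. -/
theorem fits_ribbonPattern {b c : List Bool} (hb : b.head? ≠ some false)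
    (hc : c.head? ≠ some false) : Fits (ribbonPattern b) c ↔ b = c := by
  rcases b with _ | ⟨_ | _, b⟩ <;> rcases c with _ | ⟨_ | _, c⟩ <;>
    simp_all [ribbonPattern, fits_cons, fits_nil_left, fits_nil_right, fits_map_some]

/-! ### The Schur function of a pattern -/

/-- The Schur function of a pattern of steps which follow a row of `k` boxes. -/
noncomputable def patternSchurFrom : ℕ → List (Option Bool) → NSym
  | k, [] => h k
  | k, some false :: g => patternSchurFrom (k + 1) g
  | k, none :: g => h k * patternSchurFrom 1 g
  | k, some true :: g => h k * patternSchurFrom 1 g - patternSchurFrom (k + 1) g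

/-- The Schur function of a pattern, whose first letter belongs to the first box. -/
noncomputable def patternSchur : List (Option Bool) → NSym
  | [] => 1
  | _ :: g => patternSchurFrom 1 g

theorem forall_pos_concat {l : List ℕ} (hl : ∀ a ∈ l, 0 < a) {k : ℕ} (hk : 0 < k) :
    ∀ a ∈ l ++ [k], 0 < a := by
  intro a ha
  rcases List.mem_append.mp ha with ha | ha
  · exact hl a ha
  · rwa [List.mem_singleton.mp ha]

/-- The induction reads the pattern from the left: `l` holds the rows already closed and `k` the
length of the open row. A free step closes the row, a step to the right lengthens it, and an upward
step is the difference of these two cases. -/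
theorem map_prod_mul_patternSchurFrom (φ : NSym →+ ℤ) (b : List Bool)
    (hφ : ∀ l : List ℕ, (∀ a ∈ l, 0 < a) →
      φ (l.map h).prod = if Fits (rowsPattern l) b then 1 else 0)
    (g : List (Option Bool)) (l : List ℕ) (hl : ∀ a ∈ l, 0 < a) (k : ℕ) (hk : 0 < k) :
    φ ((l.map h).prod * patternSchurFrom k g) =
      if Fits (rowsPattern (l ++ [k]) ++ g) b then 1 else 0 := by
  induction g generalizing l k with
  | nil =>
    rw [patternSchurFrom, List.append_nil, ← hφ _ (forall_pos_concat hl hk)]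
    simp
  | cons o g ih =>
    have key1 : φ ((l.map h).prod * (h k * patternSchurFrom 1 g)) =
        if Fits (rowsPattern (l ++ [k]) ++ none :: g) b then 1 else 0 := by
      have hprod : (l.map h).prod * h k = ((l ++ [k]).map h).prod := by simp
      rw [← mul_assoc, hprod, ih _ (forall_pos_concat hl hk) 1 one_pos]
      simp [rowsPattern]
    have key2 : φ ((l.map h).prod * patternSchurFrom (k + 1) g) =
        if Fits (rowsPattern (l ++ [k]) ++ some false :: g) b then 1 else 0 := by
      rw [ih l hl (k + 1) (by omega)]
      -- Writing `k` as a successor keeps the truncated `k - 1` in `rowsPattern` exact, so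
      -- lengthening the row appends one letter.
      obtain ⟨k, rfl⟩ : ∃ j, k = j + 1 := ⟨k - 1, by omega⟩
      simp [rowsPattern, List.replicate_succ']
    rcases o with _ | _ | _
    · rw [patternSchurFrom, key1]
    · rw [patternSchurFrom, key2]
    · rw [patternSchurFrom, mul_sub, map_sub, key1, key2, fits_append_some_true]

/-- A functional on `NSym` whose values on the products of the `h_k` indicate which patterns of
disjoint rows fit a word takes the analogous values on the Schur functions of all patterns. -/
theorem map_patternSchur (φ : NSym →+ ℤ) (b : List Bool)
    (hφ : ∀ l : List ℕ, (∀ a ∈ l, 0 < a) →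
      φ (l.map h).prod = if Fits (rowsPattern l) b then 1 else 0)
    (g : List (Option Bool)) (hg : ∀ o ∈ g.head?, o = none) :
    φ (patternSchur g) = if Fits g b then 1 else 0 := by
  cases g with
  | nil => exact hφ [] (by simp)
  | cons o g =>
    have : o = none := hg o rfl
    subst this
    simpa [patternSchur, rowsPattern] using
      map_prod_mul_patternSchurFrom φ b hφ g [] (by simp) 1 one_pos

/-! ### Realization by series -/

/-- The steps of a word after the letter `x`, where `true` marks the descents. -/
def stepsFrom : ℤ → List ℤ → List Bool
  | _, [] => []
  | x, y :: w => decide (y < x) :: stepsFrom y w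

/-- The word of booleans whose first letter is `true`, and whose other letters mark the descents of
`w`. -/
def wordSteps : List ℤ → List Bool
  | [] => []
  | x :: w => true :: stepsFrom x w

theorem head?_wordSteps (w : List ℤ) : (wordSteps w).head? ≠ some false := by
  cases w <;> simp [wordSteps]

theorem length_wordSteps (w : List ℤ) : (wordSteps w).length = w.length := by
  have : ∀ x w, (stepsFrom x w).length = w.length := by
    intro x w
    induction w generalizing x with
    | nil => rfl
    | cons y w ih => simp [stepsFrom, ih]
  cases w <;> simp [wordSteps, this]

/-- The hypothesis on `g` is what allows a restart: the step into the rest of the word may be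
anything, so it can be replaced by the conventional initial `true` of `wordSteps`. -/
theorem fits_row_append_stepsFrom (k : ℕ) (g : List (Option Bool)) (hg : ∀ o ∈ g.head?, o = none)
    (x : ℤ) (w : List ℤ) :
    Fits (List.replicate k (some false) ++ g) (stepsFrom x w) ↔
      k ≤ w.length ∧ (x :: w.take k).Pairwise (· ≤ ·) ∧ Fits g (wordSteps (w.drop k)) := by
  induction k generalizing x w with
  | zero =>
    cases w with
    | nil => simp [stepsFrom, wordSteps]
    | cons y w =>
      cases g with
      | nil => simp [stepsFrom, wordSteps, fits_nil_left]
      | cons o g =>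
        have : o = none := hg o rfl
        simp [stepsFrom, wordSteps, fits_cons, this]
  | succ k ih =>
    cases w with
    | nil => simp [stepsFrom, fits_nil_right]
    | cons y w =>
      simp only [List.replicate_succ, List.cons_append, stepsFrom, fits_cons, ih,
        List.take_succ_cons, List.drop_succ_cons, List.length_cons]
      simp only [← List.isChain_iff_pairwise, List.isChain_cons_cons]
      simp
      tauto

theorem cutsInto_iff_fits (a : List ℕ+) (w : List ℤ) :
    CutsInto a w ↔ Fits (rowsPattern (a.map (↑))) (wordSteps w) := by
  induction a generalizing w with
  | nil => cases w <;> simp [CutsInto, rowsPattern, wordSteps, fits_nil_left]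
  | cons k a ih =>
    have hk := k.pos
    have hr : rowsPattern ((k :: a).map (↑)) =
        none :: (List.replicate ((k : ℕ) - 1) (some false) ++ rowsPattern (a.map (↑))) := by
      simp [rowsPattern]
    have hg : ∀ o ∈ (rowsPattern (a.map (↑))).head?, o = none := by
      cases a <;> simp [rowsPattern]
    rw [hr, CutsInto]
    obtain ⟨j, hj⟩ : ∃ j, (k : ℕ) = j + 1 := ⟨k - 1, by omega⟩
    cases w with
    | nil => simp [wordSteps, fits_nil_right]
    | cons x w =>
      rw [wordSteps, fits_cons, fits_row_append_stepsFrom _ _ hg, ih, hj]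
      simp

/-! ### Coefficients of the Schur function of a pattern -/

theorem exists_pnat_list {l : List ℕ} (hl : ∀ a ∈ l, 0 < a) :
    ∃ a : List ℕ+, a.map (fun k : ℕ+ => (k : ℕ)) = l := by
  refine ⟨l.attach.map fun k => Nat.toPNat k.1 (hl _ k.2), ?_⟩
  rw [List.map_map]
  exact List.attach_map_subtype_val l

theorem prod_h_eq_single (a : List ℕ+) :
    ((a.map (fun k : ℕ+ => (k : ℕ))).map h).prod = MonoidAlgebra.single (FreeMonoid.ofList a) 1 := by
  rw [single_eq_prod_h, List.map_map]
  rfl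

/-- The coefficient of a word, as an additive map on `NSym`. -/
noncomputable def seriesCoeff (w : List ℤ) : NSym →+ ℤ where
  toFun a := toSeries a w
  map_zero' := by rw [map_zero]; rfl
  map_add' a b := by rw [map_add]; rfl

theorem toSeries_patternSchur (g : List (Option Bool)) (hg : ∀ o ∈ g.head?, o = none)
    (w : List ℤ) : toSeries (patternSchur g) w = if Fits g (wordSteps w) then 1 else 0 := by
  classical
  refine map_patternSchur (seriesCoeff w) (wordSteps w) (fun l hl => ?_) g hg
  obtain ⟨a, rfl⟩ := exists_pnat_list hl
  rw [prod_h_eq_single]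
  exact (toSeries_single a w).trans (if_congr (cutsInto_iff_fits a w) rfl rfl)


/-! ### Descent sets -/

/-- Rows start at the partial sums of the row lengths. The empty sum is included, so position `0`
counts, whereas the total is excluded by `j < l.length`. -/
theorem getElem?_rowStarts_eq_true {l : List ℕ} (hl : ∀ a ∈ l, 0 < a) (i : ℕ) :
    (rowStarts l)[i]? = some true ↔ ∃ j < l.length, (l.take j).sum = i := by
  induction l generalizing i with
  | nil => simp [rowStarts]
  | cons a l ih =>
    have ha := hl a (by simp)
    have ih' := ih fun b hb => hl b (by simp [hb])
    rw [rowStarts_cons, ← List.cons_append]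
    rcases Nat.lt_or_ge i a with hi | hi
    · rw [List.getElem?_append_left (by simp; omega)]
      constructor
      · intro h
        refine ⟨0, by simp, ?_⟩
        rcases i with _ | i
        · rfl
        · rw [List.getElem?_cons_succ, List.getElem?_replicate] at h
          split_ifs at h
          simp at h
      · rintro ⟨j, hj, h⟩
        rcases j with _ | j
        · simp only [List.take_zero, List.sum_nil] at h
          subst h; rfl
        · simp only [List.take_succ_cons, List.sum_cons] at h
          omega
    · rw [List.getElem?_append_right (by simp; omega), ih']
      simp only [List.length_cons, List.length_replicate, Nat.sub_add_cancel ha]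
      constructor
      · rintro ⟨j, hj, h⟩
        exact ⟨j + 1, by omega, by simp [h]; omega⟩
      · rintro ⟨j, hj, h⟩
        rcases j with _ | j
        · simp at h; omega
        · simp only [List.take_succ_cons, List.sum_cons] at h
          exact ⟨j, by omega, by omega⟩

/-- Descents are the row starts other than the first box, hence the condition `0 < i`. -/
theorem mem_descentSet {n : ℕ} (α : Composition n) (i : ℕ) :
    i ∈ descentSet α ↔ 0 < i ∧ (rowStarts α.blocks)[i]? = some true := by
  rw [getElem?_rowStarts_eq_true fun a => α.blocks_pos]
  simp only [descentSet, Finset.mem_image, Finset.mem_Ioo, Composition.sizeUpTo]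
  constructor
  · rintro ⟨j, ⟨h0, h1⟩, h2⟩
    refine ⟨?_, j, h1, h2⟩
    rw [← h2]
    refine List.sum_pos _ (fun a ha => α.blocks_pos (List.mem_of_mem_take ha)) ?_
    rw [Ne, List.take_eq_nil_iff, not_or]
    refine ⟨by omega, ?_⟩
    rintro h3
    simp [Composition.length, h3] at h1
  · rintro ⟨h0, j, h1, h2⟩
    refine ⟨j, ⟨?_, h1⟩, h2⟩
    rcases j with _ | j
    · simp at h2; omega
    · omega

/-- The order on words of booleans of the same length. -/
def Coarser (v u : List Bool) : Prop := List.Forall₂ (fun x y => x = true → y = true) v u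

theorem coarser_iff {v u : List Bool} : Coarser v u ↔
    v.length = u.length ∧ ∀ i : ℕ, v[i]? = some true → u[i]? = some true := by
  rw [Coarser, List.forall₂_iff_get]
  constructor
  · rintro ⟨h, h'⟩
    refine ⟨h, fun i hi => ?_⟩
    obtain ⟨h1, h2⟩ := List.getElem?_eq_some_iff.mp hi
    exact List.getElem?_eq_some_iff.mpr ⟨h ▸ h1, h' i h1 (h ▸ h1) h2⟩
  · rintro ⟨h, h'⟩
    refine ⟨h, fun i h1 h2 h3 => ?_⟩
    obtain ⟨_, h4⟩ := List.getElem?_eq_some_iff.mp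
      (h' i (List.getElem?_eq_some_iff.mpr ⟨h1, h3⟩))
    exact h4

/-- The pattern of disjoint rows is free at row starts and demands `false` elsewhere, so a fitting
word may have `true` only at row starts. -/
theorem fits_rowsPattern_iff (l : List ℕ) (b : List Bool) :
    Fits (rowsPattern l) b ↔ Coarser b (rowStarts l) := by
  have h1 : rowsPattern l = (rowStarts l).map fun x => if x then none else some false := by
    simp [rowsPattern, rowStarts, List.map_flatMap]
  rw [h1, Fits, Coarser, List.forall₂_map_left_iff]
  constructor
  · intro h
    refine h.flip.imp ?_
    rintro (_ | _) (_ | _) <;> simp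
  · intro h
    refine h.flip.imp ?_
    rintro (_ | _) (_ | _) <;> simp

theorem descentSet_subset_iff {n : ℕ} (β α : Composition n) :
    descentSet β ⊆ descentSet α ↔ Coarser (rowStarts β.blocks) (rowStarts α.blocks) := by
  rw [coarser_iff]
  have hβ := Composition.length_rowStarts_blocks β
  have hα := Composition.length_rowStarts_blocks α
  constructor
  · intro h
    refine ⟨by rw [hβ, hα], fun i hi => ?_⟩
    rcases Nat.eq_zero_or_pos i with rfl | h0
    · obtain ⟨h1, -⟩ := List.getElem?_eq_some_iff.mp hi
      rcases hs : rowStarts α.blocks with _ | ⟨_ | _, v⟩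
      · rw [hs] at hα; simp at hα; omega
      · exact absurd (by rw [hs]; rfl) (head?_rowStarts α.blocks)
      · rfl
    · exact ((mem_descentSet _ _).mp (h ((mem_descentSet _ _).mpr ⟨h0, hi⟩))).2
  · rintro ⟨-, h⟩ i hi
    rw [mem_descentSet] at hi ⊢
    exact ⟨hi.1, h i hi.2⟩

/-! ### Ribbon Schur functions as Schur functions of patterns -/

/-- All words of booleans which are coarser than a given one. -/
def coarsenings : List Bool → Finset (List Bool)
  | [] => {[]}
  | false :: u => (coarsenings u).image (false :: ·)
  | true :: u => (coarsenings u).image (false :: ·) ∪ (coarsenings u).image (true :: ·)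

theorem mem_coarsenings {v u : List Bool} : v ∈ coarsenings u ↔ Coarser v u := by
  induction u generalizing v with
  | nil => simp [coarsenings, Coarser]
  | cons x u ih =>
    cases v with
    | nil => cases x <;> simp [coarsenings, Coarser]
    | cons y v =>
      have h1 : Coarser (y :: v) (x :: u) ↔ (y = true → x = true) ∧ Coarser v u :=
        List.forall₂_cons
      cases x <;> cases y <;> simp [coarsenings, ih, h1]

theorem count_le_of_coarser {v u : List Bool} (h : Coarser v u) : v.count true ≤ u.count true := by
  induction h with
  | nil => rfl
  | @cons x y v u hxy h ih => cases x <;> cases y <;> simp_all; omega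

/-- Expanding every upward step as "close the row" minus "lengthen the row" gives one term for each
subset of the row starts that is kept, with one sign for each row start removed. -/
theorem patternSchurFrom_map_some (k : ℕ) (u : List Bool) :
    patternSchurFrom k (u.map some) = ∑ v ∈ coarsenings u,
      (-1 : ℤ) ^ (u.count true - v.count true) • ((rowLengthsFrom k v).map h).prod := by
  induction u generalizing k with
  | nil => simp [coarsenings, patternSchurFrom, rowLengthsFrom]
  | cons x u ih =>
    cases x with
    | false =>
      rw [coarsenings, Finset.sum_image (by simp), List.map_cons, patternSchurFrom, ih]
      simp [rowLengthsFrom]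
    | true =>
      rw [coarsenings, Finset.sum_union, Finset.sum_image (by simp), Finset.sum_image (by simp),
        List.map_cons, patternSchurFrom, ih, ih, Finset.mul_sum, sub_eq_neg_add,
        ← Finset.sum_neg_distrib]
      · congr 1
        · refine Finset.sum_congr rfl fun v hv => ?_
          -- The exponent is a truncated subtraction. This inequality makes it exact, so that
          -- removing a row start raises it by one.
          have := count_le_of_coarser (mem_coarsenings.mp hv)
          rw [List.count_cons_self, List.count_cons_of_ne (by simp),
            show u.count true + 1 - v.count true = (u.count true - v.count true) + 1 by omega,
            pow_succ, mul_neg_one, neg_smul, rowLengthsFrom]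
        · refine Finset.sum_congr rfl fun v hv => ?_
          rw [List.count_cons_self, List.count_cons_self, Nat.add_sub_add_right, mul_smul_comm,
            rowLengthsFrom, List.map_cons, List.prod_cons]
      · rw [Finset.disjoint_left]
        simp

/-- Inclusion of descent sets is coarsening of boolean words, so the alternating sum defining the
ribbon Schur function is the expansion of its pattern. Dropping the leading `true` of each word is
the bijection of summands; for size `0` there is no letter to drop, and that case is separate. -/
theorem ribbonSchur_eq_patternSchur {n : ℕ} (α : Composition n) :
    ribbonSchur α = patternSchur (ribbonPattern (rowStarts α.blocks)) := by
  rcases hα : rowStarts α.blocks with _ | ⟨x, u⟩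
  · have hn : n = 0 := by rw [← Composition.length_rowStarts_blocks α, hα]; rfl
    subst hn
    have hb : ∀ β : Composition 0, β.blocks = [] := by
      intro β
      have := β.blocks_sum
      rcases hβ : β.blocks with _ | ⟨a, l⟩
      · rfl
      · have h1 := β.blocks_pos (i := a) (by rw [hβ]; simp)
        rw [hβ, List.sum_cons] at this
        omega
    have h1 : ∀ β : Composition 0, β = α := fun β => by
      ext1; rw [hb, hb]
    rw [ribbonSchur, Finset.sum_eq_single α (fun β _ h => absurd (h1 β) h) (by simp)]
    simp [hComp, hb, ribbonPattern, patternSchur]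
  · have hx : x = true := by
      have := head?_rowStarts α.blocks
      rw [hα] at this
      cases x <;> simp_all
    subst hx
    have hcons : ∀ β : Composition n, ∃ v, rowStarts β.blocks = true :: v := by
      intro β
      have h1 := Composition.length_rowStarts_blocks β
      have h2 := Composition.length_rowStarts_blocks α
      rw [hα, List.length_cons] at h2
      rcases hβ : rowStarts β.blocks with _ | ⟨_ | _, v⟩
      · rw [hβ] at h1; simp at h1; omega
      · exact absurd (by rw [hβ]; rfl) (head?_rowStarts β.blocks)
      · exact ⟨v, rfl⟩
    have hlen : ∀ (β : Composition n) v, rowStarts β.blocks = true :: v →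
        β.length = v.count true + 1 := by
      intro β v hv
      rw [Composition.length, ← count_rowStarts, hv, List.count_cons_self]
    have hrow : ∀ (β : Composition n) v, rowStarts β.blocks = true :: v →
        rowLengthsFrom 1 v = β.blocks := by
      intro β v hv
      rcases hβ : β.blocks with _ | ⟨a, l⟩
      · rw [hβ] at hv; simp [rowStarts] at hv
      · rw [hβ] at hv
        have := rowLengthsFrom_tail_rowStarts a l (fun b hb => β.blocks_pos (by rw [hβ]; exact hb))
        rwa [hv] at this
    have hco : ∀ v w, Coarser (true :: v) (true :: w) ↔ Coarser v w := by
      intro v w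
      simp [Coarser]
    rw [ribbonPattern, patternSchur, patternSchurFrom_map_some, ribbonSchur]
    refine Finset.sum_nbij (fun β => (rowStarts β.blocks).tail) ?_ ?_ ?_ ?_
    · intro β hβ
      obtain ⟨v, hv⟩ := hcons β
      simpa [descentSet_subset_iff, hα, hv, hco, mem_coarsenings] using hβ
    · intro β _ β' _ h
      obtain ⟨v, hv⟩ := hcons β
      obtain ⟨v', hv'⟩ := hcons β'
      simp only [hv, hv', List.tail_cons] at h
      ext1
      rw [← hrow β v hv, ← hrow β' v' hv', h]
    · intro v hv
      have hv' : Coarser v u := mem_coarsenings.mp hv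
      obtain ⟨β, hβ⟩ := exists_composition_rowStarts (true :: v) (by simp)
      have hl : (true :: v).length = n := by
        rw [← Composition.length_rowStarts_blocks α, hα]
        simp [(coarser_iff.mp hv').1]
      subst hl
      refine ⟨β, ?_, by simp [hβ]⟩
      simp [descentSet_subset_iff, hα, hβ, hco, hv']
    · intro β hβ
      obtain ⟨v, hv⟩ := hcons β
      rw [hlen α u hα, hlen β v hv]
      simp [hv, hrow β v hv, hComp]

/-! ### Values of the pairing -/

/-- The word `j ⋯ j (j+1) ⋯ (j+1) ⋯` whose letters have multiplicities given by `l`. -/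
def packedWord : ℕ → List ℕ → List ℕ
  | _, [] => []
  | j, a :: l => List.replicate a j ++ packedWord (j + 1) l

theorem length_packedWord (j : ℕ) (l : List ℕ) : (packedWord j l).length = l.sum := by
  induction l generalizing j with
  | nil => rfl
  | cons a l ih => simp [packedWord, ih]

theorem le_of_mem_packedWord {j : ℕ} {l : List ℕ} {x : ℕ} (hx : x ∈ packedWord j l) : j ≤ x := by
  induction l generalizing j with
  | nil => simp [packedWord] at hx
  | cons a l ih =>
    rw [packedWord, List.mem_append] at hx
    rcases hx with hx | hx
    · exact (List.eq_of_mem_replicate hx).ge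
    · exact (Nat.le_succ j).trans (ih hx)

theorem pairwise_packedWord (j : ℕ) (l : List ℕ) : (packedWord j l).Pairwise (· ≤ ·) := by
  induction l generalizing j with
  | nil => simp [packedWord]
  | cons a l ih =>
    rw [packedWord, List.pairwise_append]
    refine ⟨by simp [List.pairwise_replicate], ih _, fun x hx y hy => ?_⟩
    rw [List.eq_of_mem_replicate hx]
    exact (Nat.le_succ j).trans (le_of_mem_packedWord hy)

theorem count_packedWord (j x : ℕ) (l : List ℕ) : (packedWord j l).count (j + x) = l.getD x 0 := by
  induction l generalizing j x with
  | nil => simp [packedWord]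
  | cons a l ih =>
    rw [packedWord, List.count_append, List.count_replicate]
    rcases x with _ | x
    · rw [List.count_eq_zero_of_not_mem fun h => by have := le_of_mem_packedWord h; omega]
      simp
    · rw [show j + (x + 1) = j + 1 + x by ring, ih, if_neg (by simp; omega)]
      simp

/-- Within a block the letters agree, and the next block has a larger letter. An adjacent strict
increase therefore occurs exactly where a new block begins. -/
theorem packedWord_lt_iff (j : ℕ) {l : List ℕ} (hl : ∀ a ∈ l, 0 < a) (i x y : ℕ)
    (hx : (packedWord j l)[i]? = some x) (hy : (packedWord j l)[i + 1]? = some y) :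
    x < y ↔ (rowStarts l)[i + 1]? = some true := by
  induction l generalizing j i with
  | nil => simp [packedWord] at hx
  | cons a l ih =>
    have ha := hl a (by simp)
    have hl' : ∀ b ∈ l, 0 < b := fun b hb => hl b (by simp [hb])
    rw [packedWord] at hx hy
    rw [rowStarts_cons, ← List.cons_append]
    rcases lt_trichotomy (i + 1) a with hi | hi | hi
    · rw [List.getElem?_append_left (by simp; omega)] at hx hy ⊢
      rw [List.getElem?_cons_succ, List.getElem?_replicate, if_pos (by omega)]
      rw [List.getElem?_replicate, if_pos (by omega)] at hx hy
      simp_all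
    · rw [List.getElem?_append_left (by simp; omega), List.getElem?_replicate,
        if_pos (by omega)] at hx
      rw [List.getElem?_append_right (by simp; omega)] at hy ⊢
      have h1 : i + 1 - (true :: List.replicate (a - 1) false).length = 0 := by simp; omega
      have h2 : i + 1 - (List.replicate a j).length = 0 := by simp; omega
      rw [h1]
      rw [h2] at hy
      have h3 := le_of_mem_packedWord (List.mem_of_getElem? hy)
      obtain rfl : j = x := by simpa using hx
      rcases l with _ | ⟨c, l⟩
      · simp [packedWord] at hy
      · simp [rowStarts]; omega
    · rw [List.getElem?_append_right (by simp; omega)] at hx hy ⊢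
      have h1 : i + 1 - (true :: List.replicate (a - 1) false).length = i - a + 1 := by
        simp; omega
      have h2 : i + 1 - (List.replicate a j).length = i - a + 1 := by simp; omega
      rw [h1]
      rw [h2] at hy
      rw [List.length_replicate] at hx
      exact ih _ hl' _ hx hy

theorem sum_single_apply_eq_count {n : ℕ} (i : Fin n → ℕ) (x : ℕ) :
    (∑ k, Finsupp.single (i k) 1 : ℕ →₀ ℕ) x = (List.ofFn i).count x := by
  induction n with
  | zero => simp
  | succ n ih =>
    have := ih fun k => i k.succ
    rw [Fin.sum_univ_succ, List.ofFn_succ, List.count_cons, Finsupp.add_apply, this, add_comm]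
    simp [Finsupp.single_apply]

/-- A weakly increasing word is determined by the multiplicities of its letters, since two sorted
lists that are permutations of each other are equal. -/
theorem sum_single_eq_iff {n : ℕ} (i : Fin n → ℕ) (hi : Monotone i) (a : List ℕ+) :
    (∑ k, Finsupp.single (i k) 1 = packedExponent (FreeMonoid.ofList a)) ↔
      List.ofFn i = packedWord 0 (a.map (↑)) := by
  have h1 : ∀ x, packedExponent (FreeMonoid.ofList a) x =
      (packedWord 0 (a.map (↑))).count x := by
    intro x
    have := count_packedWord 0 x (a.map (↑))
    rw [zero_add] at this
    rw [this]
    exact List.toFinsupp_apply _ _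
  constructor
  · intro h
    refine List.Perm.eq_of_pairwise' (r := (· ≤ ·)) ?_ (pairwise_packedWord _ _) ?_
    · rw [List.pairwise_ofFn]
      exact fun _ _ hij => hi hij.le
    · rw [List.perm_iff_count]
      intro x
      rw [← sum_single_apply_eq_count, h, h1]
  · intro h
    ext x
    rw [sum_single_apply_eq_count, h, h1]

theorem pairing_single (f : MvPowerSeries ℕ ℤ) (a : FreeMonoid ℕ+) :
    pairing f (MonoidAlgebra.single a 1) = f (packedExponent a) := by
  have := (MonoidAlgebra.basis (FreeMonoid ℕ+) ℤ).constr_basis ℤ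
    (fun a => MvPowerSeries.coeff (packedExponent a) f) a
  exact (congrArg _ (MonoidAlgebra.basis_apply ..).symm).trans this

/-- Only the packed word of `l` can contribute the required monomial to `F_β`, so the coefficient is
0 or 1. It is 1 when the strict increases that `D(β)` demands occur at block boundaries, which says
that the word of `β` is coarser than that of `l`. -/
theorem pairing_fundamentalQSym_prod_h {n : ℕ} (β : Composition n) (l : List ℕ)
    (hl : ∀ a ∈ l, 0 < a) : pairing (fundamentalQSym β) (l.map h).prod =
      if Fits (rowsPattern l) (rowStarts β.blocks) then 1 else 0 := by
  obtain ⟨a, rfl⟩ := exists_pnat_list hl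
  rw [prod_h_eq_single, pairing_single, fundamentalQSym]
  set l := a.map (fun k : ℕ+ => (k : ℕ)) with hldef
  have hβ := Composition.length_rowStarts_blocks β
  have hls := length_rowStarts l hl
  have hlp := length_packedWord 0 l
  have key : ∀ i : Fin n → ℕ, List.ofFn i = packedWord 0 l →
      ((∀ j k : Fin n, (k : ℕ) = j + 1 → (k : ℕ) ∈ descentSet β → i j < i k) ↔
        Fits (rowsPattern l) (rowStarts β.blocks)) := by
    intro i hi
    have hget : ∀ k : Fin n, (packedWord 0 l)[(k : ℕ)]? = some (i k) := by
      intro k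
      rw [← hi]
      simp [k.2]
    have hn : l.sum = n := by rw [← hlp, ← hi, List.length_ofFn]
    rw [fits_rowsPattern_iff, coarser_iff]
    constructor
    · intro h
      refine ⟨by omega, fun k hk => ?_⟩
      obtain ⟨hk1, -⟩ := List.getElem?_eq_some_iff.mp hk
      -- Position `0` is not a descent, so the hypothesis says nothing about it; there the first
      -- block supplies the letter `true`.
      rcases k with _ | k
      · rcases hl0 : l with _ | ⟨c, l'⟩
        · rw [hl0] at hn; simp at hn; omega
        · simp [rowStarts]
      · have h1 := hget ⟨k, by omega⟩
        have h2 := hget ⟨k + 1, by omega⟩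
        rw [← packedWord_lt_iff 0 hl k _ _ h1 h2]
        exact h _ _ rfl ((mem_descentSet _ _).mpr ⟨by simp, hk⟩)
    · rintro ⟨-, h⟩ j k hjk hk
      rw [packedWord_lt_iff 0 hl j _ _ (hget j) (hjk ▸ hget k)]
      rw [mem_descentSet, hjk] at hk
      exact h _ hk.2
  split_ifs with hf
  · have hn : (packedWord 0 l).length = n := by
      have := ((coarser_iff.mp ((fits_rowsPattern_iff _ _).mp hf))).1
      omega
    have hex : ∃ i : Fin n → ℕ, List.ofFn i = packedWord 0 l := by
      subst hn
      exact ⟨fun k => (packedWord 0 l)[k], List.ofFn_getElem⟩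
    obtain ⟨i, hi⟩ := hex
    have hmono : Monotone i := by
      have := pairwise_packedWord 0 l
      rw [← hi, List.pairwise_ofFn] at this
      exact monotone_iff_forall_lt.mpr fun j k hjk => this hjk
    have : Unique {i : Fin n → ℕ //
        (Monotone i ∧ ∀ j k : Fin n, (k : ℕ) = j + 1 → (k : ℕ) ∈ descentSet β → i j < i k) ∧
          ∑ k, Finsupp.single (i k) 1 = packedExponent (FreeMonoid.ofList a)} :=
      ⟨⟨⟨i, ⟨hmono, (key i hi).mpr hf⟩, (sum_single_eq_iff i hmono a).mpr hi⟩⟩, by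
        rintro ⟨i', ⟨h1, -⟩, h3⟩
        refine Subtype.ext (List.ofFn_injective ?_)
        rw [sum_single_eq_iff i' h1] at h3
        exact h3.trans hi.symm⟩
    rw [Nat.card_unique, Nat.cast_one]
  · have : IsEmpty {i : Fin n → ℕ //
        (Monotone i ∧ ∀ j k : Fin n, (k : ℕ) = j + 1 → (k : ℕ) ∈ descentSet β → i j < i k) ∧
          ∑ k, Finsupp.single (i k) 1 = packedExponent (FreeMonoid.ofList a)} :=
      ⟨fun ⟨i, ⟨h1, h2⟩, h3⟩ => hf ((key i ((sum_single_eq_iff i h1 a).mp h3)).mp h2)⟩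
    rw [Nat.card_of_isEmpty, Nat.cast_zero]

theorem pairing_fundamentalQSym_patternSchur {n : ℕ} (β : Composition n) (g : List (Option Bool))
    (hg : ∀ o ∈ g.head?, o = none) : pairing (fundamentalQSym β) (patternSchur g) =
      if Fits g (rowStarts β.blocks) then 1 else 0 :=
  map_patternSchur (pairing (fundamentalQSym β)).toAddMonoidHom _
    (pairing_fundamentalQSym_prod_h β) g hg


/-! ### Patterns of diagrams -/

/-- The step between two successive boxes of a diagram: `some false` to the right neighbour,
`some true` to the upper neighbour, `none` if the boxes are not neighbours. -/
def boxStep (p q : Box) : Option Bool :=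
  if q.IsRightOf p then some false else if q.IsAbove p then some true else none

theorem Box.IsRightOf.not_isAbove {p q : Box} (h : q.IsRightOf p) : ¬ q.IsAbove p := by
  intro h'
  have := h.1.symm.trans h'.2
  omega

theorem boxStep_eq_some_false {p q : Box} : boxStep p q = some false ↔ q.IsRightOf p := by
  unfold boxStep; split_ifs <;> simp_all

theorem boxStep_eq_some_true {p q : Box} : boxStep p q = some true ↔ q.IsAbove p := by
  unfold boxStep
  split_ifs with h1 h2
  · simp [h1.not_isAbove]
  · simp [h2]
  · simp [h2]

theorem boxStep_eq_none {p q : Box} : boxStep p q = none ↔ ¬ (q.IsRightOf p ∨ q.IsAbove p) := by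
  unfold boxStep; split_ifs <;> simp_all

/-- The steps of a list of boxes which follow the box `p`. -/
def boxSteps : Box → List Box → List (Option Bool)
  | _, [] => []
  | p, q :: L => boxStep p q :: boxSteps q L

/-- The pattern of a list of boxes. -/
def boxPattern : List Box → List (Option Bool)
  | [] => []
  | p :: L => none :: boxSteps p L

theorem head?_boxPattern (L : List Box) : ∀ o ∈ (boxPattern L).head?, o = none := by
  cases L <;> simp [boxPattern]

theorem boxPattern_ne_nil {L : List Box} (hL : L ≠ []) : boxPattern L ≠ [] := by
  cases L <;> simp_all [boxPattern]

theorem boxPattern_concat (L : List Box) (p q : Box) :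
    boxPattern (L ++ [p] ++ [q]) = boxPattern (L ++ [p]) ++ [boxStep p q] := by
  have h1 : ∀ x L, boxSteps x (L ++ [p] ++ [q]) = boxSteps x (L ++ [p]) ++ [boxStep p q] := by
    intro x L
    induction L generalizing x with
    | nil => rfl
    | cons y L ih =>
      simp only [List.cons_append, boxSteps]
      rw [ih]
  cases L with
  | nil => rfl
  | cons x L =>
    simp only [List.cons_append, boxPattern]
    rw [h1]

/-! ### Components and brackets -/

section SplitBy

variable {A : Type*} (r : A → A → Bool)

theorem splitBy_concat_of_eq_false (l : List A) {p q : A} (hpq : r p q = false) :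
    (l ++ [p] ++ [q]).splitBy r = (l ++ [p]).splitBy r ++ [[q]] := by
  rw [List.splitBy_append]
  · rfl
  · simp [hpq]

/-- A new element related to the last one joins the last group and leaves the earlier groups alone.
Naming the groups as `X` and `Y` lets the lists before and after be compared. -/
theorem splitBy_concat_of_eq_true (l : List A) {p q : A} (hpq : r p q = true) :
    ∃ X Y, (l ++ [p]).splitBy r = X ++ [Y ++ [p]] ∧
      (l ++ [p] ++ [q]).splitBy r = X ++ [Y ++ [p] ++ [q]] := by
  obtain ⟨X, Z, hX⟩ : ∃ X Z, (l ++ [p]).splitBy r = X ++ [Z] := by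
    rcases List.eq_nil_or_concat ((l ++ [p]).splitBy r) with h | ⟨X, Z, h⟩
    · simp [List.splitBy_eq_nil] at h
    · exact ⟨X, Z, by rw [h, List.concat_eq_append]⟩
  obtain ⟨h1, h2, h3, h4⟩ := List.splitBy_eq_iff.mp hX
  obtain ⟨Y, y, rfl⟩ : ∃ Y y, Z = Y ++ [y] := by
    rcases List.eq_nil_or_concat Z with rfl | ⟨Y, y, h⟩
    · simp at h2
    · exact ⟨Y, y, by rw [h, List.concat_eq_append]⟩
  obtain rfl : p = y := by
    rw [List.flatten_append, List.flatten_singleton, ← List.append_assoc] at h1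
    exact (List.append_inj' h1 rfl).2 |> List.singleton_inj.mp
  refine ⟨X, Y, hX, List.splitBy_eq_iff.mpr ⟨by simp [h1], by simpa using h2, ?_, ?_⟩⟩
  · intro m hm
    rcases List.mem_append.mp hm with hm | hm
    · exact h3 m (by simp [hm])
    · rw [List.mem_singleton.mp hm, List.isChain_append]
      exact ⟨h3 _ (by simp), by simp, by simp [hpq]⟩
  · rw [List.isChain_append] at h4 ⊢
    refine ⟨h4.1, by simp, fun x hx y hy => ?_⟩
    obtain ⟨ha, hb, h5⟩ := h4.2.2 x hx (Y ++ [p]) (by simp)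
    obtain rfl : Y ++ [p] ++ [q] = y := by simpa using hy
    refine ⟨ha, by simp, ?_⟩
    rwa [List.head_append_of_ne_nil]

end SplitBy

/-- The row lengths of a connected list of boxes. -/
def rowLengths (C : List Box) : List ℕ :=
  (C.splitBy fun p q => decide (q.IsRightOf p)).map List.length

/-- The row lengths of the components of a list of boxes. -/
def listComponents (L : List Box) : List (List ℕ) :=
  (L.splitBy fun p q => decide (q.IsRightOf p ∨ q.IsAbove p)).map rowLengths

theorem components_eq_listComponents (B : Finset Box) : components B = listComponents B.sort := rfl

theorem listComponents_ne_nil (L : List Box) (p : Box) : listComponents (L ++ [p]) ≠ [] := by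
  simp [listComponents, List.splitBy_eq_nil]

theorem listComponents_concat_of_eq_none (L : List Box) {p q : Box} (h : boxStep p q = none) :
    listComponents (L ++ [p] ++ [q]) = listComponents (L ++ [p]) ++ [[1]] := by
  rw [listComponents, splitBy_concat_of_eq_false _ _ (by simpa [boxStep_eq_none] using h),
    List.map_append]
  rfl

/-- An upper neighbour stays in the last component but is not a right neighbour, so it opens a new
row of length 1 there. -/
theorem listComponents_concat_of_eq_true (L : List Box) {p q : Box} (h : boxStep p q = some true) :
    ∃ X c, c ≠ [] ∧ listComponents (L ++ [p]) = X ++ [c] ∧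
      listComponents (L ++ [p] ++ [q]) = X ++ [c ++ [1]] := by
  rw [boxStep_eq_some_true] at h
  obtain ⟨X, Y, h1, h2⟩ := splitBy_concat_of_eq_true
    (fun p q : Box => decide (q.IsRightOf p ∨ q.IsAbove p)) L (p := p) (q := q) (by simp [h])
  refine ⟨X.map rowLengths, rowLengths (Y ++ [p]), ?_, ?_, ?_⟩
  · simp [rowLengths, List.splitBy_eq_nil]
  · rw [listComponents, h1, List.map_append, List.map_singleton]
  · rw [listComponents, h2, List.map_append, List.map_singleton, rowLengths, rowLengths,
      splitBy_concat_of_eq_false, List.map_append]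
    · rfl
    · have : ¬ q.IsRightOf p := fun h' => h'.not_isAbove h
      simp [this]

/-- A right neighbour joins both the last component and its last row, so the two splittings have to
be followed together. -/
theorem listComponents_concat_of_eq_false (L : List Box) {p q : Box}
    (h : boxStep p q = some false) :
    ∃ X c k, listComponents (L ++ [p]) = X ++ [c ++ [k]] ∧
      listComponents (L ++ [p] ++ [q]) = X ++ [c ++ [k + 1]] := by
  rw [boxStep_eq_some_false] at h
  obtain ⟨X, Y, h1, h2⟩ := splitBy_concat_of_eq_true
    (fun p q : Box => decide (q.IsRightOf p ∨ q.IsAbove p)) L (p := p) (q := q) (by simp [h])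
  obtain ⟨Z, R, h3, h4⟩ := splitBy_concat_of_eq_true
    (fun p q : Box => decide (q.IsRightOf p)) Y (p := p) (q := q) (by simp [h])
  refine ⟨X.map rowLengths, Z.map List.length, (R ++ [p]).length, ?_, ?_⟩
  · rw [listComponents, h1, List.map_append, List.map_singleton, rowLengths, h3, List.map_append,
      List.map_singleton]
  · rw [listComponents, h2, List.map_append, List.map_singleton, rowLengths, h4, List.map_append,
      List.map_singleton, List.length_append (as := R ++ [p])]
    rfl

/-! ### Concatenation, near concatenation and the bracket when a box is added -/

theorem nearConcat_append (s c d : List ℕ) (hc : c ≠ []) :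
    nearConcat s (c ++ d) = nearConcat s c ++ d := by
  induction s with
  | nil => rfl
  | cons x s ih =>
    cases s with
    | nil => cases c <;> simp_all [nearConcat]
    | cons y s => simp [nearConcat, ih]

theorem nearConcat_concat (s : List ℕ) (k m : ℕ) :
    nearConcat (s ++ [k]) [m] = s ++ [k + m] := by
  induction s with
  | nil => rfl
  | cons x s ih =>
    cases s with
    | nil => simp [nearConcat]
    | cons y s => simpa [nearConcat] using ih

theorem nearConcat_concat_right (s c : List ℕ) (k m : ℕ) :
    nearConcat (nearConcat s (c ++ [k])) [m] = nearConcat s (c ++ [k + m]) := by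
  cases c with
  | nil =>
    rcases List.eq_nil_or_concat s with rfl | ⟨s, j, rfl⟩
    · simp [nearConcat]
    · simp [nearConcat_concat, add_assoc]
  | cons x c =>
    rw [nearConcat_append _ _ _ (by simp), nearConcat_concat, nearConcat_append _ _ _ (by simp)]

theorem bracketList_concat {X : List (List ℕ)} (hX : X ≠ []) (c : List ℕ) :
    bracketList (X ++ [c]) =
      (bracketList X).image (· ++ c) ∪ (bracketList X).image (nearConcat · c) := by
  cases X with
  | nil => exact absurd rfl hX
  | cons a X => simp [bracketList, List.foldl_append]

/-- Both ways of joining the last component affect only its first row. As `c` is nonempty, the new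
row is added after the join. -/
theorem bracketList_concat_concat_one (X : List (List ℕ)) {c : List ℕ} (hc : c ≠ []) :
    bracketList (X ++ [c ++ [1]]) = (bracketList (X ++ [c])).image (· ++ [1]) := by
  by_cases hX : X = []
  · subst hX; simp [bracketList]
  · rw [bracketList_concat hX, bracketList_concat hX, Finset.image_union, Finset.image_image,
      Finset.image_image]
    congr 2
    · funext s; simp
    · funext s; simp [nearConcat_append _ _ _ hc]

/-- Lengthening the last row commutes with both ways of joining, even when that row is also the
first row of its component. -/
theorem bracketList_concat_concat_succ (X : List (List ℕ)) (c : List ℕ) (k : ℕ) :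
    bracketList (X ++ [c ++ [k + 1]]) =
      (bracketList (X ++ [c ++ [k]])).image (nearConcat · [1]) := by
  by_cases hX : X = []
  · subst hX; simp [bracketList, nearConcat_concat]
  · rw [bracketList_concat hX, bracketList_concat hX, Finset.image_union, Finset.image_image,
      Finset.image_image]
    congr 2
    · funext s
      simp only [Function.comp_apply, ← List.append_assoc, nearConcat_concat]
    · funext s; simp [nearConcat_concat_right]

/-! ### Fitting compositions when a box is added -/

theorem fits_concat {g : List (Option Bool)} {o : Option Bool} {b : List Bool} {x : Bool} :
    Fits (g ++ [o]) (b ++ [x]) ↔ Fits g b ∧ (o = none ∨ o = some x) := by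
  rw [fits_append]
  constructor
  · rintro ⟨c, c', h, h1, h2⟩
    have hl := h2.length_eq
    obtain ⟨rfl, rfl⟩ := List.append_inj' h (by simpa using hl)
    exact ⟨h1, by simpa [fits_cons, fits_nil_left] using h2⟩
  · rintro ⟨h1, h2⟩
    exact ⟨b, [x], rfl, h1, by simpa [fits_cons, fits_nil_left] using h2⟩

/-- A composition which fits a pattern. -/
def FitsBlocks (g : List (Option Bool)) (l : List ℕ) : Prop :=
  (∀ a ∈ l, 0 < a) ∧ Fits g (rowStarts l)

theorem fitsBlocks_concat_one {g : List (Option Bool)} {o : Option Bool} {l : List ℕ} :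
    FitsBlocks (g ++ [o]) (l ++ [1]) ↔ FitsBlocks g l ∧ (o = none ∨ o = some true) := by
  have h1 : rowStarts (l ++ [1]) = rowStarts l ++ [true] := by simp [rowStarts]
  simp only [FitsBlocks, h1, fits_concat, List.forall_mem_append, List.forall_mem_singleton]
  tauto

theorem fitsBlocks_concat_succ {g : List (Option Bool)} {o : Option Bool} {l : List ℕ} {k : ℕ}
    (hk : 0 < k) : FitsBlocks (g ++ [o]) (l ++ [k + 1]) ↔
      FitsBlocks g (l ++ [k]) ∧ (o = none ∨ o = some false) := by
  have h1 : rowStarts (l ++ [k + 1]) = rowStarts (l ++ [k]) ++ [false] := by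
    obtain ⟨j, rfl⟩ : ∃ j, k = j + 1 := ⟨k - 1, by omega⟩
    simp [rowStarts, List.replicate_succ']
  simp only [FitsBlocks, h1, fits_concat, List.forall_mem_append, List.forall_mem_singleton]
  simp [hk, and_assoc]

/-- The last box of a composition either forms a row by itself or extends a longer row, according to
the last letter of its word. -/
theorem fitsBlocks_concat {g : List (Option Bool)} (hg : g ≠ []) {o : Option Bool} {l : List ℕ} :
    FitsBlocks (g ++ [o]) l ↔
      ((o = none ∨ o = some true) ∧ ∃ s, FitsBlocks g s ∧ s ++ [1] = l) ∨
      ((o = none ∨ o = some false) ∧ ∃ s, FitsBlocks g s ∧ nearConcat s [1] = l) := by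
  constructor
  · intro h
    rcases List.eq_nil_or_concat l with rfl | ⟨s, k, rfl⟩
    · have := h.2.length_eq
      simp [rowStarts] at this
    · have hk := h.1 k (by simp)
      by_cases hk1 : k = 1
      · subst hk1
        rw [List.concat_eq_append, fitsBlocks_concat_one] at h
        exact Or.inl ⟨h.2, s, h.1, by simp⟩
      · obtain ⟨j, rfl⟩ : ∃ j, k = j + 1 := ⟨k - 1, by omega⟩
        rw [List.concat_eq_append, fitsBlocks_concat_succ (by omega)] at h
        exact Or.inr ⟨h.2, s ++ [j], h.1, by rw [nearConcat_concat, List.concat_eq_append]⟩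
  · rintro (⟨ho, s, hs, rfl⟩ | ⟨ho, s, hs, rfl⟩)
    · exact fitsBlocks_concat_one.mpr ⟨hs, ho⟩
    -- There must be a row to lengthen: `nearConcat [] [1]` is `[1]`, whose last letter is `true`.
    -- The hypothesis `hg` rules this case out.
    · rcases List.eq_nil_or_concat s with rfl | ⟨s, k, rfl⟩
      · have := hs.2
        rw [show rowStarts [] = [] from rfl, fits_nil_right] at this
        exact absurd this hg
      · rw [List.concat_eq_append] at hs ⊢
        rw [nearConcat_concat]
        exact (fitsBlocks_concat_succ (hs.1 k (by simp))).mpr ⟨hs, ho⟩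

/-- Both sides follow the same recursion when the last box is added: it may start a row or lengthen
one if it is not a neighbour of the preceding box, and is forced otherwise. -/
theorem mem_bracketList_listComponents (L : List Box) (l : List ℕ) :
    l ∈ bracketList (listComponents L) ↔ FitsBlocks (boxPattern L) l := by
  induction L using List.reverseRecOn generalizing l with
  | nil =>
    simp only [listComponents, List.splitBy_nil, List.map_nil, bracketList, boxPattern, FitsBlocks,
      fits_nil_left, Finset.mem_singleton]
    cases l <;> simp [rowStarts]
  | append_singleton L q ih =>
    rcases List.eq_nil_or_concat L with rfl | ⟨L, p, rfl⟩
    · have h1 : listComponents ([] ++ [q]) = [[1]] := rfl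
      have h2 : boxPattern ([] ++ [q]) = [none] := rfl
      rw [h1, h2]
      simp only [bracketList, List.foldl_nil, Finset.mem_singleton, FitsBlocks]
      constructor
      · rintro rfl
        simp [rowStarts, fits_cons, fits_nil_left]
      · rintro ⟨hl, h⟩
        have hs := length_rowStarts l hl
        rw [← h.length_eq, List.length_singleton] at hs
        rcases l with _ | ⟨a, l⟩
        · simp at hs
        · have ha := hl a (by simp)
          rcases l with _ | ⟨b, l⟩
          · simp at hs; rw [hs]
          · have hb := hl b (by simp)
            simp only [List.sum_cons] at hs; omega
    · rw [List.concat_eq_append] at ih ⊢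
      rw [boxPattern_concat, fitsBlocks_concat (boxPattern_ne_nil (by simp))]
      rcases ho : boxStep p q with _ | _ | _
      · rw [listComponents_concat_of_eq_none L ho, bracketList_concat (listComponents_ne_nil L p)]
        simp [ih]
      · obtain ⟨X, c, k, h1, h2⟩ := listComponents_concat_of_eq_false L ho
        rw [h2, bracketList_concat_concat_succ, ← h1]
        simp [ih]
      · obtain ⟨X, c, hc, h1, h2⟩ := listComponents_concat_of_eq_true L ho
        rw [h2, bracketList_concat_concat_one X hc, ← h1]
        simp [ih]

theorem mem_bracket_iff {n : ℕ} (β : Composition n) (B : Finset Box) :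
    β ∈ bracket n B ↔ Fits (boxPattern B.sort) (rowStarts β.blocks) := by
  rw [bracket, Finset.mem_filter, components_eq_listComponents, mem_bracketList_listComponents,
    FitsBlocks]
  simp only [Finset.mem_univ, true_and, and_iff_right_iff_imp]
  exact fun _ a => β.blocks_pos

theorem length_boxPattern (L : List Box) : (boxPattern L).length = L.length := by
  have : ∀ p L, (boxSteps p L).length = L.length := by
    intro p L
    induction L generalizing p with
    | nil => rfl
    | cons q L ih => simp [boxSteps, ih]
  cases L <;> simp [boxPattern, this]

theorem head?_ribbonPattern (b : List Bool) : ∀ o ∈ (ribbonPattern b).head?, o = none := by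
  cases b <;> simp [ribbonPattern]

/-- The Schur function of a diagram is the sum of the ribbon Schur functions over its bracket. -/
theorem sum_bracket_ribbonSchur (B : Finset Box) :
    ∑ γ ∈ bracket B.card B, ribbonSchur γ = patternSchur (boxPattern B.sort) := by
  -- The coefficients of each word are compared. At most one ribbon contributes, the one whose row
  -- starts are the steps of the word, and it lies in the bracket exactly when the pattern fits.
  apply toSeries_injective
  rw [map_sum]
  funext w
  have h1 : (∑ γ ∈ bracket B.card B, toSeries (ribbonSchur γ)) w =
      ∑ γ ∈ bracket B.card B, toSeries (ribbonSchur γ) w := Finset.sum_apply w _ _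
  rw [h1, toSeries_patternSchur _ (head?_boxPattern _)]
  have h2 : ∀ γ ∈ bracket B.card B, toSeries (ribbonSchur γ) w =
      if rowStarts γ.blocks = wordSteps w then 1 else 0 := by
    intro γ _
    rw [ribbonSchur_eq_patternSchur, toSeries_patternSchur _ (head?_ribbonPattern _)]
    exact if_congr (fits_ribbonPattern (head?_rowStarts _) (head?_wordSteps w)) rfl rfl
  rw [Finset.sum_congr rfl h2]
  split_ifs with hf
  · obtain ⟨γ, hγ⟩ := exists_composition_rowStarts (wordSteps w) (head?_wordSteps w)
    have hl := hf.length_eq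
    rw [length_boxPattern, Finset.length_sort] at hl
    revert γ
    rw [← hl]
    intro γ hγ
    rw [Finset.sum_eq_single γ, if_pos hγ]
    · intro γ' _ hne
      refine if_neg fun h => hne ?_
      ext1
      exact rowStarts_injOn (fun a => γ'.blocks_pos) (fun a => γ.blocks_pos) (h.trans hγ.symm)
    · intro h
      exact absurd ((mem_bracket_iff γ B).mpr (hγ ▸ hf)) h
  · refine Finset.sum_eq_zero fun γ hγ => if_neg fun h => hf ?_
    rw [← h]
    exact (mem_bracket_iff γ B).mp hγ

/-! ### Semistandard fillings -/

/-- In a list of boxes in weakly northeastern order, successive boxes which are not neighbours are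
separated strictly. -/
def IsStaircase : List Box → Prop
  | [] => True
  | p :: L => (∀ y ∈ L, p.row ≤ y.row ∧ p.col ≤ y.col) ∧
      (∀ x ∈ L.head?, boxStep p x = none → ∀ y ∈ L, y.row ≠ p.row ∧ y.col ≠ p.col) ∧ IsStaircase L

/-- The condition imposed by semistandardness on two boxes in the reading order. -/
def SemistandardPair (τ : Box → ℤ) (p q : Box) : Prop :=
  (p.row = q.row → p.col < q.col → τ p ≤ τ q) ∧ (p.col = q.col → p.row < q.row → τ q < τ p)

theorem Box.ext_row_col {p q : Box} (h1 : p.row = q.row) (h2 : p.col = q.col) : p = q :=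
  ofLex.injective (Prod.ext h1 h2)

/-- The conditions on all pairs of boxes reduce to conditions on successive ones. Across a gap a
staircase has no common row or column, so nothing is required. Across a neighbouring step the
condition on a distant box follows by transitivity through the next box. -/
theorem pairwise_semistandardPair_iff (τ : Box → ℤ) (L : List Box) (hL : IsStaircase L) :
    L.Pairwise (SemistandardPair τ) ↔ Fits (boxPattern L) (wordSteps (L.map τ)) := by
  induction L with
  | nil => simp [boxPattern, wordSteps, fits_nil_left]
  | cons p L ih =>
    cases L with
    | nil => simp [boxPattern, wordSteps, fits_cons, fits_nil_left, boxSteps, stepsFrom]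
    | cons x L =>
      obtain ⟨-, hnone, hL'⟩ := hL
      have ih := ih hL'
      have hx : ∀ y ∈ x :: L, x.row ≤ y.row ∧ x.col ≤ y.col := by
        intro y hy
        rcases List.mem_cons.mp hy with rfl | hy
        · simp
        · exact hL'.1 y hy
      simp only [boxPattern, wordSteps, List.map_cons, fits_cons, true_or, true_and] at ih
      rw [List.pairwise_cons, ih]
      simp only [boxPattern, wordSteps, List.map_cons, boxSteps, stepsFrom, fits_cons, true_or,
        true_and]
      refine and_congr_left fun hf => ?_
      have hpw := ih.mpr hf
      have hxy : ∀ y ∈ x :: L, y = x ∨ SemistandardPair τ x y := by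
        intro y hy
        rcases List.mem_cons.mp hy with rfl | hy
        · exact Or.inl rfl
        · exact Or.inr ((List.pairwise_cons.mp hpw).1 y hy)
      rcases ho : boxStep p x with _ | _ | _
      · have := hnone x rfl ho
        simp only [true_or, iff_true]
        intro y hy
        exact ⟨fun h => absurd h.symm (this y hy).1, fun h => absurd h.symm (this y hy).2⟩
      · rw [boxStep_eq_some_false] at ho
        simp only [reduceCtorEq, Option.some.injEq, false_or, eq_comm (a := false),
          decide_eq_false_iff_not, not_lt]
        constructor
        · intro h
          exact (h x (by simp)).1 ho.1.symm (by rw [ho.2]; omega)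
        · intro h y hy
          have hle := hx y hy
          refine ⟨fun hr _ => ?_, fun hc => ?_⟩
          · rcases hxy y hy with rfl | hs
            · exact h
            · rcases hle.2.eq_or_lt with hc | hc
              · rw [← Box.ext_row_col (ho.1.trans hr) hc]; exact h
              · exact h.trans (hs.1 (ho.1.trans hr) hc)
          · have := ho.2; omega
      · rw [boxStep_eq_some_true] at ho
        simp only [reduceCtorEq, Option.some.injEq, false_or, eq_comm (a := true),
          decide_eq_true_eq]
        constructor
        · intro h
          exact (h x (by simp)).2 ho.1.symm (by rw [ho.2]; omega)
        · intro h y hy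
          have hle := hx y hy
          refine ⟨fun hr => ?_, fun hc _ => ?_⟩
          · have := ho.2; omega
          · rcases hxy y hy with rfl | hs
            · exact h
            · rcases hle.1.eq_or_lt with hr | hr
              · rw [← Box.ext_row_col hr (ho.1.trans hc)]; exact h
              · exact (hs.2 (ho.1.trans hc) hr).trans h

theorem readingWord_eq_map {B : Finset Box} (τ : B → ℤ) (σ : Box → ℤ) (hσ : ∀ p : B, σ p = τ p) :
    readingWord τ = B.sort.map σ := by
  apply List.ext_getElem
  · simp [readingWord]
  · intro i h1 h2
    simp only [readingWord, List.getElem_ofFn, List.getElem_map]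
    rw [← hσ]
    rfl

theorem Box.lt_iff {p q : Box} : p < q ↔ p.row < q.row ∨ p.row = q.row ∧ p.col < q.col :=
  Prod.Lex.lt_iff

/-- The reading order goes upwards while column-strictness goes downwards, so for columns the two
boxes exchange roles. -/
theorem isSemistandard_iff_pairwise {B : Finset Box} (τ : B → ℤ) (σ : Box → ℤ)
    (hσ : ∀ p : B, σ p = τ p) : IsSemistandard τ ↔ B.sort.Pairwise (SemistandardPair σ) := by
  have hlt : B.sort.Pairwise (· < ·) := (Finset.sortedLT_sort B).pairwise
  constructor
  · intro h
    refine List.Pairwise.imp_of_mem ?_ hlt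
    intro p q hp hq _
    rw [Finset.mem_sort] at hp hq
    refine ⟨fun h1 h2 => ?_, fun h1 h2 => ?_⟩
    · have := (h ⟨p, hp⟩ ⟨q, hq⟩).1 h1 h2
      rwa [← hσ, ← hσ] at this
    · have := (h ⟨q, hq⟩ ⟨p, hp⟩).2 h1.symm h2
      rwa [← hσ, ← hσ] at this
  · intro h
    have key : ∀ p ∈ B, ∀ q ∈ B, p < q → SemistandardPair σ p q := by
      intro p hp q hq hpq
      obtain ⟨i, hi, rfl⟩ := List.getElem_of_mem ((Finset.mem_sort (· ≤ ·)).mpr hp)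
      obtain ⟨j, hj, rfl⟩ := List.getElem_of_mem ((Finset.mem_sort (· ≤ ·)).mpr hq)
      rcases lt_trichotomy i j with hij | hij | hij
      · exact List.pairwise_iff_getElem.mp h i j hi hj hij
      · subst hij; exact absurd hpq (lt_irrefl _)
      · exact absurd hpq (List.pairwise_iff_getElem.mp hlt j i hj hi hij).asymm
    rintro ⟨p, hp⟩ ⟨q, hq⟩
    rw [← hσ, ← hσ]
    refine ⟨fun h1 h2 => ?_, fun h1 h2 => ?_⟩
    · exact (key p hp q hq (Box.lt_iff.mpr (Or.inr ⟨h1, h2⟩))).1 h1 h2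
    · exact (key q hq p hp (Box.lt_iff.mpr (Or.inl h2))).2 h1.symm h2

theorem readingWord_injective {B : Finset Box} :
    Function.Injective (readingWord : (B → ℤ) → List ℤ) := by
  intro τ τ' h
  have h1 := List.ofFn_injective h
  funext p
  simpa using congrFun h1 ((B.orderIsoOfFin rfl).symm p)

/-- A filling is determined by its reading word, so each coefficient is 0 or 1. For a staircase,
semistandardness is read off from the steps of that word. -/
theorem diagramSchur_eq_toSeries (B : Finset Box) (hB : IsStaircase B.sort) :
    diagramSchur B = toSeries (patternSchur (boxPattern B.sort)) := by
  classical
  funext w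
  rw [toSeries_patternSchur _ (head?_boxPattern _), diagramSchur]
  have key : ∀ τ : B → ℤ, IsSemistandard τ ↔
      Fits (boxPattern B.sort) (wordSteps (readingWord τ)) := by
    intro τ
    -- The value `0` outside `B` is never read.
    let σ : Box → ℤ := fun p => if hp : p ∈ B then τ ⟨p, hp⟩ else 0
    have hσ : ∀ p : B, σ p = τ p := fun p => dif_pos p.2
    rw [isSemistandard_iff_pairwise τ σ hσ, pairwise_semistandardPair_iff σ _ hB,
      readingWord_eq_map τ σ hσ]
  split_ifs with hf
  · have hl := hf.length_eq
    rw [length_boxPattern, Finset.length_sort, length_wordSteps] at hl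
    obtain ⟨τ, rfl⟩ : ∃ τ : B → ℤ, readingWord τ = w := by
      refine ⟨fun p => w[((B.orderIsoOfFin rfl).symm p : ℕ)], ?_⟩
      apply List.ext_getElem
      · simp [readingWord, hl]
      · intro i h1 h2
        simp [readingWord]
    have : Unique {τ' : B → ℤ // IsSemistandard τ' ∧ readingWord τ' = readingWord τ} :=
      ⟨⟨⟨τ, (key τ).mpr hf, rfl⟩⟩, fun τ' => Subtype.ext (readingWord_injective τ'.2.2)⟩
    rw [Nat.card_unique, Nat.cast_one]
  · have : IsEmpty {τ : B → ℤ // IsSemistandard τ ∧ readingWord τ = w} :=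
      ⟨fun ⟨τ, h1, h2⟩ => hf (h2 ▸ (key τ).mp h1)⟩
    rw [Nat.card_of_isEmpty, Nat.cast_zero]


/-! ### The coproduct of a ribbon Schur function -/

/-- The element `a ⊗ b` or `b ⊗ a`, where the side of `a` is given by a boolean. -/
noncomputable def sideTmul (x : Bool) (a b : NSym) : NSym ⊗[ℤ] NSym :=
  if x then b ⊗ₜ a else a ⊗ₜ b

theorem sideTmul_not (x : Bool) (a b : NSym) : sideTmul (!x) a b = sideTmul x b a := by
  cases x <;> rfl

theorem sideTmul_mul (x : Bool) (c a b : NSym) :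
    sideTmul x (c * a) b = sideTmul x c 1 * sideTmul x a b := by
  cases x <;> simp [sideTmul]

theorem sideTmul_sub (x : Bool) (c a b : NSym) :
    sideTmul x (c - a) b = sideTmul x c b - sideTmul x a b := by
  cases x <;> simp [sideTmul, TensorProduct.sub_tmul, TensorProduct.tmul_sub]

/-- The sum of `s_γ ⊗ s_δ` over all fillings by `γ = false` and `δ = true` of the boxes reached by
the steps `u`, after a row of `k` boxes which are filled with `x`. -/
noncomputable def fillingSum : Bool → ℕ → List Bool → NSym ⊗[ℤ] NSym
  | x, k, [] => sideTmul x (h k) 1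
  | x, k, s :: u =>
    (if s then sideTmul x (h k) 1 * fillingSum x 1 u - fillingSum x (k + 1) u
      else fillingSum x (k + 1) u) +
    if x = s then sideTmul x (h k) 1 * fillingSum (!x) 1 u else 0

/-! ### The coproduct of a row and of a ribbon -/

theorem h_zero : h 0 = 1 := rfl

theorem h_of_pnat (k : ℕ+) : h k = MonoidAlgebra.of ℤ (FreeMonoid ℕ+) (FreeMonoid.of k) := by
  rw [h, dif_pos k.pos]; rfl

theorem comul_h (k : ℕ) :
    comul (h k) = ∑ i ∈ Finset.range (k + 1), h i ⊗ₜ[ℤ] h (k - i) := by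
  rcases Nat.eq_zero_or_pos k with rfl | hk
  · simp [h_zero, Algebra.TensorProduct.one_def]
  · obtain ⟨k, rfl⟩ : ∃ j : ℕ+, k = j := ⟨⟨k, hk⟩, rfl⟩
    rw [h_of_pnat, comul, MonoidAlgebra.lift_of, FreeMonoid.lift_eval_of]

/-- The terms are sorted by the symbol of the last box: all `k` boxes carry `γ`, or the last `j + 1`
boxes carry `δ`. Only this last symbol matters for what follows. -/
theorem comul_h_eq_add (k : ℕ) : comul (h k) = sideTmul false (h k) 1 +
    ∑ j ∈ Finset.range k, sideTmul false (h (k - 1 - j)) 1 * sideTmul true (h (j + 1)) 1 := by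
  rw [comul_h, Finset.sum_range_succ, add_comm, ← Finset.sum_range_reflect]
  congr 1
  · simp [sideTmul, h_zero]
  · refine Finset.sum_congr rfl fun j hj => ?_
    rw [Finset.mem_range] at hj
    simp only [sideTmul, Bool.false_eq_true, if_false, if_true,
      Algebra.TensorProduct.tmul_mul_tmul, one_mul, mul_one]
    rw [show k - (k - 1 - j) = j + 1 by omega]

/-- Induction on the steps, with the open row already cut into `γ` and `δ`. In the term `j`, the `k
- 1 - j` boxes with `γ` are closed off and the open row consists of `j + 1` boxes with `δ`. -/
theorem comul_patternSchurFrom (k : ℕ) (hk : 0 < k) (u : List Bool) :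
    comul (patternSchurFrom k (u.map some)) = fillingSum false k u +
      ∑ j ∈ Finset.range k, sideTmul false (h (k - 1 - j)) 1 * fillingSum true (j + 1) u := by
  induction u generalizing k with
  | nil =>
    rw [List.map_nil, patternSchurFrom, comul_h_eq_add]
    rfl
  | cons s u ih =>
    have ih1 := ih 1 one_pos
    have ih2 := ih (k + 1) (by omega)
    -- The term `j = 0` is split off: there `δ` occupies only the new box, so it is the change from
    -- `γ` to `δ` at this step.
    rw [Finset.sum_range_succ'] at ih2
    have e1 : sideTmul false (h 0) 1 = 1 := by
      simp [sideTmul, h_zero, Algebra.TensorProduct.one_def]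
    simp only [Finset.sum_range_one, Nat.sub_self, Nat.zero_add, e1, one_mul] at ih1
    have e2 : ∀ j, k + 1 - 1 - (j + 1) = k - 1 - j := fun j => by omega
    simp only [e2] at ih2
    simp only [Nat.add_sub_cancel, Nat.sub_zero, Nat.zero_add] at ih2
    cases s with
    | false =>
      rw [List.map_cons, patternSchurFrom, ih2]
      simp only [fillingSum, Bool.false_eq_true, Bool.true_eq_false, if_false, if_true, add_zero,
        Bool.not_false]
      abel
    | true =>
      -- The product contains a change from `γ` to `δ` on the upward step; it cancels against the
      -- split-off term of `ih2`. The change from `δ` to `γ` survives.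
      rw [List.map_cons, patternSchurFrom, map_sub, map_mul, ih1, ih2, comul_h_eq_add]
      simp only [fillingSum, Bool.false_eq_true, if_false, if_true, add_zero, Bool.not_true,
        mul_add, mul_sub, add_mul, Finset.sum_mul, Finset.sum_add_distrib, Finset.sum_sub_distrib,
        mul_assoc]
      abel

/-! ### Fillings of paths -/

/-- The symbol of a box in the filling for which `B` consists of the boxes carrying `γ = false`. -/
def symbol (B : Finset Box) (p : Box) : Bool := decide (p ∉ B)

/-- A filling of a path is admissible if the symbol changes only from `γ` to `δ` along a step to the
right and from `δ` to `γ` along a step upwards. Here `x` is the symbol of the first box. -/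
def Admissible (B : Finset Box) : Bool → Box → List Box → Prop
  | _, _, [] => True
  | x, p, q :: L => (symbol B q = x ∨ boxStep p q = some x) ∧ Admissible B (symbol B q) q L

instance (B : Finset Box) : ∀ (x : Bool) (p : Box) (L : List Box), Decidable (Admissible B x p L)
  | _, _, [] => by unfold Admissible; infer_instance
  | x, p, q :: L => by
    have := instDecidableAdmissible B (symbol B q) q L
    unfold Admissible; infer_instance

theorem admissible_congr {B B' : Finset Box} (x : Bool) (p : Box) (L : List Box)
    (hB : ∀ q ∈ L, symbol B q = symbol B' q) : Admissible B x p L ↔ Admissible B' x p L := by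
  induction L generalizing x p with
  | nil => rfl
  | cons q L ih =>
    rw [Admissible, Admissible, hB q (by simp), ih _ _ fun y hy => hB y (by simp [hy])]

/-- The boxes of a list carrying a given symbol. -/
def symbolBoxes (B : Finset Box) (x : Bool) (L : List Box) : List Box :=
  L.filter fun q => symbol B q = x

theorem symbolBoxes_congr {B B' : Finset Box} (x : Bool) (L : List Box)
    (hB : ∀ q ∈ L, symbol B q = symbol B' q) : symbolBoxes B x L = symbolBoxes B' x L :=
  List.filter_congr fun q hq => by rw [hB q hq]

/-! ### Geometry of paths -/

theorem boxStep_eq_some_iff {p q : Box} {s : Bool} :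
    boxStep p q = some s ↔ if s then q.IsAbove p else q.IsRightOf p := by
  cases s
  · simpa using boxStep_eq_some_false
  · simpa using boxStep_eq_some_true

theorem le_of_boxStep {p q : Box} {s : Bool} (hs : boxStep p q = some s) :
    p.row ≤ q.row ∧ p.col ≤ q.col ∧ p < q := by
  rw [boxStep_eq_some_iff] at hs
  rw [Box.lt_iff]
  cases s
  · have h1 := hs.1; have h2 := hs.2; omega
  · have h1 := hs.1; have h2 := hs.2; omega

theorem le_of_mem_path {p : Box} {L : List Box} {u : List Bool} (hL : boxSteps p L = u.map some) :
    ∀ y ∈ L, p.row ≤ y.row ∧ p.col ≤ y.col ∧ p < y := by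
  induction L generalizing p u with
  | nil => simp
  | cons q L ih =>
    cases u with
    | nil => simp [boxSteps] at hL
    | cons s u =>
      simp only [boxSteps, List.map_cons, List.cons.injEq] at hL
      have h1 := le_of_boxStep hL.1
      intro y hy
      rcases List.mem_cons.mp hy with rfl | hy
      · exact h1
      · have h2 := ih hL.2 y hy
        exact ⟨h1.1.trans h2.1, h1.2.1.trans h2.2.1, h1.2.2.trans h2.2.2⟩

theorem pairwise_lt_path {p : Box} {L : List Box} {u : List Bool}
    (hL : boxSteps p L = u.map some) : (p :: L).Pairwise (· < ·) := by
  induction L generalizing p u with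
  | nil => simp
  | cons q L ih =>
    rw [List.pairwise_cons]
    refine ⟨fun y hy => (le_of_mem_path hL y hy).2.2, ?_⟩
    cases u with
    | nil => simp [boxSteps] at hL
    | cons s u =>
      simp only [boxSteps, List.map_cons, List.cons.injEq] at hL
      exact ih hL.2

/-- A box at least two steps further along the path is not a neighbour. Hence a change of symbol
produces a free step in the pattern of the symbol that was left. -/
theorem boxStep_eq_none_of_path {p q y : Box} {L : List Box} {s : Bool} {u : List Bool}
    (hs : boxStep p q = some s) (hL : boxSteps q L = u.map some) (hy : y ∈ L) :
    boxStep p y = none := by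
  have h1 := le_of_mem_path hL y hy
  rw [boxStep_eq_none, Box.IsRightOf, Box.IsAbove]
  rw [Box.lt_iff] at h1
  rw [boxStep_eq_some_iff] at hs
  cases s
  · have h2 := hs.1; have h3 := hs.2; omega
  · have h2 := hs.1; have h3 := hs.2; omega

theorem patternSchurFrom_boxSteps {k : ℕ} {p : Box} {L : List Box}
    (hL : ∀ y ∈ L, boxStep p y = none) :
    patternSchurFrom k (boxSteps p L) = h k * patternSchur (boxPattern L) := by
  cases L with
  | nil => simp [boxSteps, patternSchurFrom, boxPattern, patternSchur]
  | cons q L => rw [boxSteps, hL q (by simp), patternSchurFrom, boxPattern, patternSchur]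

/-- The contribution of a filling to `fillingSum`. -/
noncomputable def fillingTerm (x : Bool) (k : ℕ) (p : Box) (L : List Box) (B : Finset Box) :
    NSym ⊗[ℤ] NSym :=
  if Admissible B x p L then
    sideTmul x (patternSchurFrom k (boxSteps p (symbolBoxes B x L)))
      (patternSchur (boxPattern (symbolBoxes B (!x) L)))
  else 0

/-- With the symbol unchanged, the open row meets the actual step `s`, and the recursion is that of
`patternSchurFrom`. The set `B'` may differ from `B` at `q`, which allows `q` to be inserted or
omitted. -/
theorem fillingTerm_cons_of_eq {x s : Bool} {k : ℕ} {p q : Box} {L : List Box}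
    {B B' : Finset Box} (hs : boxStep p q = some s) (hq : symbol B q = x)
    (hB : ∀ y ∈ L, symbol B y = symbol B' y) :
    fillingTerm x k p (q :: L) B =
      if s then sideTmul x (h k) 1 * fillingTerm x 1 q L B' - fillingTerm x (k + 1) q L B'
      else fillingTerm x (k + 1) q L B' := by
  have h1 : symbolBoxes B x (q :: L) = q :: symbolBoxes B' x L := by
    rw [← symbolBoxes_congr x L hB, symbolBoxes, List.filter_cons_of_pos (by simpa using hq)]
    rfl
  have h2 : symbolBoxes B (!x) (q :: L) = symbolBoxes B' (!x) L := by
    rw [← symbolBoxes_congr _ L hB, symbolBoxes, List.filter_cons_of_neg (by simp [hq])]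
    rfl
  have h3 : Admissible B x p (q :: L) ↔ Admissible B' x q L := by
    rw [Admissible, hq, admissible_congr x q L hB]
    simp
  simp only [fillingTerm, h1, h2, h3, boxSteps, hs]
  by_cases ha : Admissible B' x q L
  · simp only [if_pos ha]
    cases s
    · simp [patternSchurFrom]
    · simp [patternSchurFrom, sideTmul_sub, sideTmul_mul]
  · simp [if_neg ha]

/-- With the symbol changed, the open row is closed for good and contributes the factor `h k`, while
a new row of length 1 opens on the other side of the tensor product. -/
theorem fillingTerm_cons_of_ne {x s : Bool} {k : ℕ} {p q : Box} {L : List Box}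
    {B B' : Finset Box} {u : List Bool} (hs : boxStep p q = some s)
    (hL : boxSteps q L = u.map some) (hq : symbol B q = !x)
    (hB : ∀ y ∈ L, symbol B y = symbol B' y) :
    fillingTerm x k p (q :: L) B =
      if x = s then sideTmul x (h k) 1 * fillingTerm (!x) 1 q L B' else 0 := by
  have h1 : symbolBoxes B (!x) (q :: L) = q :: symbolBoxes B' (!x) L := by
    rw [← symbolBoxes_congr _ L hB, symbolBoxes, List.filter_cons_of_pos (by simpa using hq)]
    rfl
  have h2 : symbolBoxes B x (q :: L) = symbolBoxes B' x L := by
    rw [← symbolBoxes_congr _ L hB, symbolBoxes, List.filter_cons_of_neg (by simp [hq])]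
    rfl
  have h3 : Admissible B x p (q :: L) ↔ x = s ∧ Admissible B' (!x) q L := by
    rw [Admissible, hq, admissible_congr _ q L hB, hs]
    exact and_congr_left fun _ => by cases x <;> cases s <;> decide
  have h4 : patternSchurFrom k (boxSteps p (symbolBoxes B' x L)) =
      h k * patternSchur (boxPattern (symbolBoxes B' x L)) :=
    patternSchurFrom_boxSteps fun y hy =>
      boxStep_eq_none_of_path hs hL (List.mem_of_mem_filter hy)
  simp only [fillingTerm, h1, h2, h3, h4]
  by_cases hx : x = s
  · by_cases ha : Admissible B' (!x) q L
    · rw [if_pos ⟨hx, ha⟩, if_pos hx, if_pos ha, sideTmul_mul, sideTmul_not, Bool.not_not]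
      rfl
    · rw [if_neg fun h => ha h.2, if_pos hx, if_neg ha, mul_zero]
  · rw [if_neg fun h => hx h.1, if_neg hx]

theorem symbol_of_notMem {B : Finset Box} {q : Box} (hq : q ∉ B) : symbol B q = true := by
  simp [symbol, hq]

theorem symbol_insert_self (B : Finset Box) (q : Box) : symbol (insert q B) q = false := by
  simp [symbol]

theorem symbol_insert_of_ne {B : Finset Box} {q y : Box} (hy : y ≠ q) :
    symbol (insert q B) y = symbol B y := by
  simp [symbol, hy]

/-- Turns the recursive sum into a sum over actual fillings, encoded by the set of boxes carrying
`γ`; inadmissible ones contribute zero. -/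
theorem sum_fillingTerm (x : Bool) (k : ℕ) (p : Box) (L : List Box) (u : List Bool)
    (hL : boxSteps p L = u.map some) :
    ∑ B ∈ L.toFinset.powerset, fillingTerm x k p L B = fillingSum x k u := by
  induction L generalizing x k p u with
  | nil =>
    obtain rfl : u = [] := List.map_eq_nil_iff.mp hL.symm
    simp [fillingTerm, Admissible, symbolBoxes, boxSteps, boxPattern, patternSchur,
      patternSchurFrom, fillingSum]
  | cons q L ih =>
    cases u with
    | nil => simp [boxSteps] at hL
    | cons s u =>
      simp only [boxSteps, List.map_cons, List.cons.injEq] at hL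
      obtain ⟨hs, hL⟩ := hL
      have hqL : ∀ y ∈ L, y ≠ q := fun y hy => ((le_of_mem_path hL y hy).2.2).ne'
      have hq : q ∉ L.toFinset := fun h => hqL q (List.mem_toFinset.mp h) rfl
      -- Subsets avoiding `q` give it the symbol `δ`, those containing it give it `γ`. Which half
      -- keeps the symbol therefore depends on `x`.
      rw [List.toFinset_cons, Finset.sum_powerset_insert hq]
      have hout : ∀ B ∈ L.toFinset.powerset, symbol B q = true := fun B hB =>
        symbol_of_notMem fun h => hq (Finset.mem_powerset.mp hB h)
      have hin : ∀ B ∈ L.toFinset.powerset, ∀ y ∈ L, symbol (insert q B) y = symbol B y :=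
        fun B _ y hy => symbol_insert_of_ne (hqL y hy)
      have hstay : ∀ x, ∑ B ∈ L.toFinset.powerset,
          (if s then sideTmul x (h k) 1 * fillingTerm x 1 q L B - fillingTerm x (k + 1) q L B
            else fillingTerm x (k + 1) q L B) =
          if s then sideTmul x (h k) 1 * fillingSum x 1 u - fillingSum x (k + 1) u
            else fillingSum x (k + 1) u := by
        intro x
        cases s
        · simp [ih _ _ _ _ hL]
        · simp [← Finset.mul_sum, ih _ _ _ _ hL]
      have hswitch : ∀ x, ∑ B ∈ L.toFinset.powerset,
          (if x = s then sideTmul x (h k) 1 * fillingTerm (!x) 1 q L B else 0) =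
          if x = s then sideTmul x (h k) 1 * fillingSum (!x) 1 u else 0 := by
        intro x
        by_cases hx : x = s
        · simp only [if_pos hx, ← Finset.mul_sum, ih _ _ _ _ hL]
        · simp [if_neg hx]
      rw [fillingSum, ← hstay, ← hswitch]
      cases x with
      | false =>
        rw [add_comm]
        congr 1
        · exact Finset.sum_congr rfl fun B hB =>
            fillingTerm_cons_of_eq hs (symbol_insert_self B q) (hin B hB)
        · exact Finset.sum_congr rfl fun B hB =>
            fillingTerm_cons_of_ne hs hL (hout B hB) fun _ _ => rfl
      | true =>
        congr 1
        · exact Finset.sum_congr rfl fun B hB =>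
            fillingTerm_cons_of_eq hs (hout B hB) fun _ _ => rfl
        · exact Finset.sum_congr rfl fun B hB =>
            fillingTerm_cons_of_ne hs hL (symbol_insert_self B q) (hin B hB)


/-! ### Admissible fillings and decompositions -/

/-- `p` is to the left of `q` in the same row, or above `q` in the same column. -/
def Precedes (p q : Box) : Prop :=
  (p.row = q.row ∧ p.col < q.col) ∨ (p.col = q.col ∧ q.row < p.row)

/-- Fillings which weakly increase along rows and down columns. -/
def IsFilling (B : Finset Box) (L : List Box) : Prop :=
  ∀ p ∈ L, ∀ q ∈ L, q ∈ B → Precedes p q → p ∈ B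

/-- On a path all boxes between two boxes of one row, or of one column, lie on the path, so
monotonicity need only be checked on successive boxes. Along a row the path follows the order
`Precedes`, and along a column it runs against it. -/
theorem isFilling_iff_admissible (B : Finset Box) (p : Box) (L : List Box) (u : List Bool)
    (hL : boxSteps p L = u.map some) :
    IsFilling B (p :: L) ↔ Admissible B (symbol B p) p L := by
  induction L generalizing p u with
  | nil =>
    simp only [IsFilling, Admissible, List.mem_singleton, iff_true]
    rintro _ rfl _ rfl h _
    exact h
  | cons q L ih =>
    cases u with
    | nil => simp [boxSteps] at hL
    | cons s u =>
      have hp := le_of_mem_path hL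
      simp only [boxSteps, List.map_cons, List.cons.injEq] at hL
      obtain ⟨hs, hL⟩ := hL
      rw [Admissible, ← ih q u hL, hs]
      rw [boxStep_eq_some_iff] at hs
      have hq : ∀ y ∈ L, q.row ≤ y.row ∧ q.col ≤ y.col ∧
          (q.row < y.row ∨ q.row = y.row ∧ q.col < y.col) :=
        fun y hy => by simpa only [Box.lt_iff] using le_of_mem_path hL y hy
      constructor
      · intro h
        refine ⟨?_, fun a ha b hb => h a (by simp [ha]) b (by simp [hb])⟩
        cases s with
        | false =>
          have h1 := h p (by simp) q (by simp)
          have h2 : Precedes p q := Or.inl ⟨hs.1.symm, by have := hs.2; omega⟩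
          by_cases hqB : q ∈ B
          · simp [symbol, hqB, h1 hqB h2]
          · by_cases hpB : p ∈ B <;> simp [symbol, hqB, hpB]
        | true =>
          have h1 := h q (by simp) p (by simp)
          have h2 : Precedes q p := Or.inr ⟨hs.1, by have := hs.2; omega⟩
          by_cases hpB : p ∈ B
          · simp [symbol, hpB, h1 hpB h2]
          · by_cases hqB : q ∈ B <;> simp [symbol, hqB, hpB]
      · rintro ⟨hpq, h⟩ a ha b hb hbB hab
        rcases List.mem_cons.mp ha with rfl | ha2
        · rcases List.mem_cons.mp hb with rfl | hb
          · rcases hab with hab | hab <;> omega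
          · have hle := hp b hb
            cases s with
            | false =>
              rcases hab with hab | hab
              · have hqB : q ∈ B := by
                  rcases List.mem_cons.mp hb with rfl | hb'
                  · exact hbB
                  · refine h q (by simp) b hb hbB (Or.inl ?_)
                    have := hs.1; have := hq b hb'; omega
                by_contra hn
                simp [symbol, hqB, hn] at hpq
              · have := hs.1; omega
            | true =>
              rcases hab with hab | hab
              · have h1 := hs.2
                rcases List.mem_cons.mp hb with rfl | hb'
                · omega
                · have := hq b hb'; omega
              · omega
        · rcases List.mem_cons.mp hb with rfl | hb
          · have hle := hp a ha2
            cases s with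
            | false =>
              have h1 := hs.2
              rcases hab with hab | hab
              · omega
              · rcases List.mem_cons.mp ha2 with rfl | ha3
                · omega
                · have := hq a ha3; omega
            | true =>
              rcases hab with hab | hab
              · omega
              · have hqB : q ∈ B := by
                  by_contra hn
                  simp [symbol, hbB, hn] at hpq
                rcases List.mem_cons.mp ha2 with rfl | ha3
                · exact hqB
                · refine h a ha2 q (by simp) hqB (Or.inr ?_)
                  have := hs.1; have := hq a ha3; omega
          · exact h a ha2 b hb hbB hab

/-- A run of `γ` ends with a step to the right, which moves beyond its column. A later `γ` in its
row would force the skipped box to be `γ`. For `δ` the same argument applies with an upward step and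
columns. -/
theorem isStaircase_symbolBoxes (B : Finset Box) (x : Bool) (p : Box) (L : List Box)
    (u : List Bool) (hL : boxSteps p L = u.map some) (hB : IsFilling B (p :: L)) :
    IsStaircase (symbolBoxes B x (p :: L)) := by
  induction L generalizing p u with
  | nil =>
    by_cases hp : symbol B p = x <;> simp [symbolBoxes, hp, IsStaircase]
  | cons q L ih =>
    have hadm := (isFilling_iff_admissible B p _ u hL).mp hB
    cases u with
    | nil => simp [boxSteps] at hL
    | cons s u =>
      have hp := le_of_mem_path hL
      simp only [boxSteps, List.map_cons, List.cons.injEq] at hL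
      obtain ⟨hs, hL⟩ := hL
      have ih := ih q u hL fun a ha b hb => hB a (by simp [ha]) b (by simp [hb])
      by_cases hpx : symbol B p = x
      · have h1 : symbolBoxes B x (p :: q :: L) = p :: symbolBoxes B x (q :: L) :=
          List.filter_cons_of_pos (by simpa using hpx)
        rw [h1]
        refine ⟨fun y hy => ?_, fun z hz hnone y hy => ?_, ih⟩
        · have := hp y (List.mem_of_mem_filter hy)
          exact ⟨this.1, this.2.1⟩
        · by_cases hqx : symbol B q = x
          · have h2 : symbolBoxes B x (q :: L) = q :: symbolBoxes B x L :=
              List.filter_cons_of_pos (by simpa using hqx)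
            rw [h2] at hz
            obtain rfl : q = z := by simpa using hz
            rw [hs] at hnone
            cases hnone
          · have hsx : s = x := by
              rw [Admissible, hpx, hs] at hadm
              simpa [hqx] using hadm.1
            have hyx : symbol B y = x := by simpa using List.of_mem_filter hy
            have hyL : y ∈ L := by
              rcases List.mem_cons.mp (List.mem_of_mem_filter hy) with rfl | hy'
              · exact absurd hyx hqx
              · exact hy'
            have hq := le_of_mem_path hL y hyL
            rw [Box.lt_iff] at hq
            have hle := hp y (by simp [hyL])
            rw [boxStep_eq_some_iff] at hs
            subst hsx
            cases s with
            | false =>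
              have h1 := hs.1
              have h2 := hs.2
              have hyB : y ∈ B := by simpa [symbol] using hyx
              have hqB : q ∉ B := by simpa [symbol] using hqx
              refine ⟨fun hr => hqB ?_, by omega⟩
              exact hB q (by simp) y (by simp [hyL]) hyB (Or.inl (by omega))
            | true =>
              have h1 := hs.1
              have h2 := hs.2
              have hyB : y ∉ B := by simpa [symbol] using hyx
              have hqB : q ∈ B := by simpa [symbol] using hqx
              refine ⟨by omega, fun hr => hyB ?_⟩
              exact hB y (by simp [hyL]) q (by simp) hqB (Or.inr (by omega))
      · have h1 : symbolBoxes B x (p :: q :: L) = symbolBoxes B x (q :: L) :=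
          List.filter_cons_of_neg (by simpa using hpx)
        rw [h1]
        exact ih

/-! ### Ribbons as paths -/

theorem boxSteps_row (r c j : ℕ) (M : List Box) :
    boxSteps (toLex (r, c)) ((List.range j).map (fun i => (toLex (r, c + 1 + i) : Box)) ++ M) =
      (List.replicate j false).map some ++ boxSteps (toLex (r, c + j)) M := by
  induction j generalizing c with
  | zero => rfl
  | succ j ih =>
    have h1 : boxStep (toLex (r, c)) (toLex (r, c + 1)) = some false :=
      boxStep_eq_some_false.mpr ⟨rfl, rfl⟩
    have h2 : (List.range (j + 1)).map (fun i => (toLex (r, c + 1 + i) : Box)) =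
        toLex (r, c + 1) :: (List.range j).map (fun i => (toLex (r, c + 1 + 1 + i) : Box)) := by
      rw [List.range_succ_eq_map, List.map_cons, List.map_map]
      congr 1
      refine List.map_congr_left fun i _ => ?_
      simp only [Function.comp_apply, Nat.succ_eq_add_one]
      congr 2
      omega
    rw [h2, List.cons_append, boxSteps, h1, ih, List.replicate_succ, List.map_cons,
      List.cons_append, show c + 1 + j = c + (j + 1) by omega]

theorem ribbonFrom_cons (r c a : ℕ) (ha : 0 < a) (l : List ℕ) :
    ribbonFrom r c (a :: l) = toLex (r, c) ::
      ((List.range (a - 1)).map (fun i => (toLex (r, c + 1 + i) : Box)) ++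
        ribbonFrom (r + 1) (c + (a - 1)) l) := by
  obtain ⟨a, rfl⟩ : ∃ j, a = j + 1 := ⟨a - 1, by omega⟩
  rw [ribbonFrom, List.range_succ_eq_map, List.map_cons, List.map_map, List.cons_append]
  congr 2
  refine List.map_congr_left fun i _ => ?_
  simp only [Function.comp_apply, Nat.succ_eq_add_one]
  congr 2
  omega

/-- The box `(r, c)` stands for the last box of the preceding row, so that the first step of every
row is upwards. -/
theorem boxSteps_ribbonFrom (r c : ℕ) (l : List ℕ) (hl : ∀ a ∈ l, 0 < a) :
    boxSteps (toLex (r, c)) (ribbonFrom (r + 1) c l) = (rowStarts l).map some := by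
  induction l generalizing r c with
  | nil => rfl
  | cons a l ih =>
    have h1 : boxStep (toLex (r, c)) (toLex (r + 1, c)) = some true :=
      boxStep_eq_some_true.mpr ⟨rfl, rfl⟩
    rw [ribbonFrom_cons _ _ _ (hl a (by simp)), boxSteps, h1, boxSteps_row,
      ih _ _ fun b hb => hl b (by simp [hb]), rowStarts_cons]
    simp

theorem boxPattern_ribbonFrom (l : List ℕ) (hl : ∀ a ∈ l, 0 < a) :
    boxPattern (ribbonFrom 0 0 l) = ribbonPattern (rowStarts l) := by
  cases l with
  | nil => rfl
  | cons a l =>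
    rw [ribbonFrom_cons _ _ _ (hl a (by simp)), boxPattern, boxSteps_row,
      boxSteps_ribbonFrom _ _ _ fun b hb => hl b (by simp [hb]), rowStarts_cons, ribbonPattern,
      List.map_append]

theorem ribbonFrom_eq_nil_or_path (l : List ℕ) (hl : ∀ a ∈ l, 0 < a) :
    ribbonFrom 0 0 l = [] ∨
      ∃ p L u, ribbonFrom 0 0 l = p :: L ∧ boxSteps p L = List.map some u := by
  have h1 := boxPattern_ribbonFrom l hl
  rcases h2 : ribbonFrom 0 0 l with _ | ⟨p, L⟩
  · exact Or.inl rfl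
  · refine Or.inr ⟨p, L, (rowStarts l).tail, rfl, ?_⟩
    rw [h2] at h1
    rcases h3 : rowStarts l with _ | ⟨x, v⟩
    · simp [h3, boxPattern, ribbonPattern] at h1
    · simpa [h3, boxPattern, ribbonPattern] using h1

/-! ### The coproduct in terms of decompositions -/

theorem isStaircase_symbolBoxes_ribbonFrom (l : List ℕ) (hl : ∀ a ∈ l, 0 < a) (B : Finset Box)
    (hB : IsFilling B (ribbonFrom 0 0 l)) (x : Bool) :
    IsStaircase (symbolBoxes B x (ribbonFrom 0 0 l)) := by
  rcases ribbonFrom_eq_nil_or_path l hl with h | ⟨p, L, u, h, hu⟩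
  · rw [h]; trivial
  · rw [h] at hB ⊢
    exact isStaircase_symbolBoxes B x p L u hu hB

theorem pairwise_lt_ribbonFrom (l : List ℕ) (hl : ∀ a ∈ l, 0 < a) :
    (ribbonFrom 0 0 l).Pairwise (· < ·) := by
  rcases ribbonFrom_eq_nil_or_path l hl with h | ⟨p, L, u, h, hu⟩
  · simp [h]
  · rw [h]; exact pairwise_lt_path hu

/-- A ribbon is listed in reading order, so sorting a subdiagram amounts to filtering that list. -/
theorem sort_filter_toFinset {L : List Box} (hL : L.Pairwise (· < ·)) (B : Finset Box)
    (P : Box → Bool) (hB : ∀ p, p ∈ B ↔ p ∈ L ∧ P p) : B.sort = L.filter P := by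
  have h1 : B.sort.Pairwise (· < ·) := (Finset.sortedLT_sort B).pairwise
  have h2 : (L.filter P).Pairwise (· < ·) := hL.filter P
  refine List.Perm.eq_of_pairwise' (r := (· ≤ ·)) (h1.imp le_of_lt) (h2.imp le_of_lt) ?_
  rw [List.perm_ext_iff_of_nodup (h1.imp ne_of_lt) (h2.imp ne_of_lt)]
  intro p
  rw [Finset.mem_sort, hB, List.mem_filter]

-- The two symbols of the first box give the two halves of the coproduct of a single box; all
-- further boxes are handled by `sum_fillingTerm`.
open Classical in
theorem comul_patternSchur_path (L : List Box) (hL : L = [] ∨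
    ∃ p L' u, L = p :: L' ∧ boxSteps p L' = List.map some u) :
    comul (patternSchur (boxPattern L)) = ∑ B ∈ L.toFinset.powerset with IsFilling B L,
      patternSchur (boxPattern (symbolBoxes B false L)) ⊗ₜ[ℤ]
        patternSchur (boxPattern (symbolBoxes B true L)) := by
  rw [Finset.sum_filter]
  rcases hL with rfl | ⟨p, L, u, rfl, hu⟩
  · simp [IsFilling, boxPattern, symbolBoxes, patternSchur, Algebra.TensorProduct.one_def]
  · have hpL : ∀ y ∈ L, y ≠ p := fun y hy => ((le_of_mem_path hu y hy).2.2).ne'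
    have hp : p ∉ L.toFinset := fun h => hpL p (List.mem_toFinset.mp h) rfl
    have h1 : ∀ (B : Finset Box) (x : Bool), symbol B p = x →
        symbolBoxes B x (p :: L) = p :: symbolBoxes B x L ∧
        symbolBoxes B (!x) (p :: L) = symbolBoxes B (!x) L := by
      intro B x hx
      exact ⟨List.filter_cons_of_pos (by simpa using hx),
        List.filter_cons_of_neg (by simp [hx])⟩
    have h2 : fillingSum false 1 u + fillingSum true 1 u =
        comul (patternSchur (boxPattern (p :: L))) := by
      rw [boxPattern, patternSchur, hu, comul_patternSchurFrom 1 one_pos]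
      simp [sideTmul, h_zero, ← Algebra.TensorProduct.one_def]
    rw [List.toFinset_cons, Finset.sum_powerset_insert hp, ← h2, add_comm,
      ← sum_fillingTerm false 1 p L u hu, ← sum_fillingTerm true 1 p L u hu]
    congr 1
    · refine Finset.sum_congr rfl fun B hB => ?_
      have hx : symbol B p = true := symbol_of_notMem fun h => hp (Finset.mem_powerset.mp hB h)
      have h3 := h1 B true hx
      rw [Bool.not_true] at h3
      rw [isFilling_iff_admissible B p L u hu, hx, h3.1, h3.2, fillingTerm, sideTmul, if_pos rfl,
        boxPattern, patternSchur, Bool.not_true]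
      by_cases ha : Admissible B true p L <;> simp only [ha, if_true, if_false]
    · refine Finset.sum_congr rfl fun B hB => ?_
      have hx : symbol (insert p B) p = false := symbol_insert_self B p
      have h3 := h1 _ false hx
      have hin : ∀ y ∈ L, symbol (insert p B) y = symbol B y :=
        fun y hy => symbol_insert_of_ne (hpL y hy)
      rw [Bool.not_false] at h3
      rw [isFilling_iff_admissible _ p L u hu, hx, h3.1, h3.2, fillingTerm, sideTmul,
        if_neg Bool.false_ne_true, boxPattern, patternSchur, Bool.not_false, symbolBoxes_congr _ L hin,
        symbolBoxes_congr _ L hin]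
      by_cases ha : Admissible B false p L <;>
        simp only [ha, admissible_congr _ _ _ hin, if_true, if_false]

open Classical in
theorem decompositions_eq {n : ℕ} (α : Composition n) : decompositions α =
    ((ribbonFrom 0 0 α.blocks).toFinset.powerset.filter
      fun B => IsFilling B (ribbonFrom 0 0 α.blocks)).image fun B => (B, ribbon α \ B) := by
  have hf : ∀ B ∈ (ribbon α).powerset, ((∀ p ∈ ribbon α, ∀ q ∈ B,
      (p.row = q.row ∧ p.col < q.col) ∨ (p.col = q.col ∧ q.row < p.row) → p ∈ B) ↔
      IsFilling B (ribbonFrom 0 0 α.blocks)) := by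
    intro B hB
    rw [Finset.mem_powerset] at hB
    constructor
    · intro h p hp q _ hqB hpq
      exact h p (List.mem_toFinset.mpr hp) q hqB hpq
    · intro h p hp q hq hpq
      exact h p (List.mem_toFinset.mp hp) q (List.mem_toFinset.mp (hB hq)) hq hpq
  rw [decompositions, Finset.filter_congr hf]
  rfl

theorem sort_of_subset_ribbon {n : ℕ} (α : Composition n) {B : Finset Box} (hB : B ⊆ ribbon α) :
    B.sort = symbolBoxes B false (ribbonFrom 0 0 α.blocks) ∧
      (ribbon α \ B).sort = symbolBoxes B true (ribbonFrom 0 0 α.blocks) := by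
  have hpw := pairwise_lt_ribbonFrom α.blocks fun a => α.blocks_pos
  constructor
  · refine sort_filter_toFinset hpw _ _ fun p => ?_
    simp only [symbol, decide_eq_false_iff_not, not_not, decide_eq_true_eq]
    exact ⟨fun hp => ⟨List.mem_toFinset.mp (hB hp), hp⟩, fun hp => hp.2⟩
  · refine sort_filter_toFinset hpw _ _ fun p => ?_
    simp only [symbol, decide_eq_true_eq, Finset.mem_sdiff, ribbon, List.mem_toFinset]

/-- The coproduct of a ribbon Schur function. -/
theorem comul_ribbonSchur {n : ℕ} (α : Composition n) : comul (ribbonSchur α) =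
    ∑ p ∈ decompositions α, patternSchur (boxPattern p.1.sort) ⊗ₜ[ℤ]
      patternSchur (boxPattern p.2.sort) := by
  classical
  have hpos : ∀ a ∈ α.blocks, 0 < a := fun a => α.blocks_pos
  rw [ribbonSchur_eq_patternSchur, ← boxPattern_ribbonFrom _ hpos,
    comul_patternSchur_path _ (ribbonFrom_eq_nil_or_path _ hpos), decompositions_eq,
    Finset.sum_image fun B _ B' _ h => congrArg Prod.fst h]
  refine Finset.sum_congr rfl fun B hB => ?_
  obtain ⟨h1, h2⟩ := sort_of_subset_ribbon α (Finset.mem_powerset.mp (Finset.mem_filter.mp hB).1)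
  rw [h1, h2]

theorem isStaircase_of_mem_decompositions {n : ℕ} (α : Composition n)
    {p : Finset Box × Finset Box} (hp : p ∈ decompositions α) :
    IsStaircase p.1.sort ∧ IsStaircase p.2.sort := by
  classical
  rw [decompositions_eq, Finset.mem_image] at hp
  obtain ⟨B, hB, rfl⟩ := hp
  rw [Finset.mem_filter, Finset.mem_powerset] at hB
  obtain ⟨h1, h2⟩ := sort_of_subset_ribbon α hB.1
  rw [h1, h2]
  exact ⟨isStaircase_symbolBoxes_ribbonFrom _ (fun a => α.blocks_pos) B hB.2 _,
    isStaircase_symbolBoxes_ribbonFrom _ (fun a => α.blocks_pos) B hB.2 _⟩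

/-! ### Skewing -/

/-- The functional of `F_β` takes the value 1 or 0 on the second tensor factor, according to
membership in its bracket, and so acts as a filter on the decompositions. -/
theorem skewRight_ribbonSchur {m n : ℕ} (α : Composition m) (β : Composition n) :
    skewRight (ribbonSchur α) (fundamentalQSym β) =
      ∑ p ∈ decompositions α with β ∈ bracket n p.2, patternSchur (boxPattern p.1.sort) := by
  rw [skewRight, comul_ribbonSchur, map_sum, map_sum, Finset.sum_filter]
  refine Finset.sum_congr rfl fun p _ => ?_
  rw [LinearMap.lTensor_tmul, TensorProduct.rid_tmul,
    pairing_fundamentalQSym_patternSchur _ _ (head?_boxPattern _)]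
  simp only [mem_bracket_iff]
  split_ifs <;> simp

theorem skewLeft_ribbonSchur {m n : ℕ} (α : Composition m) (β : Composition n) :
    skewLeft (fundamentalQSym β) (ribbonSchur α) =
      ∑ p ∈ decompositions α with β ∈ bracket n p.1, patternSchur (boxPattern p.2.sort) := by
  rw [skewLeft, comul_ribbonSchur, map_sum, map_sum, Finset.sum_filter]
  refine Finset.sum_congr rfl fun p _ => ?_
  rw [LinearMap.rTensor_tmul, TensorProduct.lid_tmul,
    pairing_fundamentalQSym_patternSchur _ _ (head?_boxPattern _)]
  simp only [mem_bracket_iff]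
  split_ifs <;> simp

/-- `NSym` is cocommutative. -/
theorem comm_comul (a : NSym) : TensorProduct.comm ℤ NSym NSym (comul a) = comul a := by
  have h1 : (Algebra.TensorProduct.comm ℤ NSym NSym).toAlgHom.comp comul = comul := by
    refine MonoidAlgebra.algHom_ext' ?_ (Subsingleton.elim _ _)
    apply FreeMonoid.hom_eq
    intro k
    have h2 : comul (MonoidAlgebra.of ℤ (FreeMonoid ℕ+) (FreeMonoid.of k)) =
        ∑ i ∈ Finset.range ((k : ℕ) + 1), h i ⊗ₜ[ℤ] h (k - i) := by
      rw [← h_of_pnat, comul_h]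
    change Algebra.TensorProduct.comm ℤ NSym NSym
      (comul (MonoidAlgebra.of ℤ (FreeMonoid ℕ+) (FreeMonoid.of k))) =
        comul (MonoidAlgebra.of ℤ (FreeMonoid ℕ+) (FreeMonoid.of k))
    rw [h2, map_sum, ← Finset.sum_range_reflect]
    refine Finset.sum_congr rfl fun i hi => ?_
    rw [Finset.mem_range] at hi
    rw [Algebra.TensorProduct.comm_tmul, show (k : ℕ) + 1 - 1 - i = k - i by omega,
      show (k : ℕ) - (k - i) = i by omega]
  exact DFunLike.congr_fun h1 a

/-- Evaluating the second factor is evaluating the first after exchanging the factors, and the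
coproduct is invariant under the exchange. -/
theorem skewRight_eq_skewLeft (a : NSym) (f : MvPowerSeries ℕ ℤ) :
    skewRight a f = skewLeft f a := by
  have key : ∀ t : NSym ⊗[ℤ] NSym, TensorProduct.rid ℤ NSym ((pairing f).lTensor NSym t) =
      TensorProduct.lid ℤ NSym ((pairing f).rTensor NSym (TensorProduct.comm ℤ NSym NSym t)) := by
    intro t
    induction t using TensorProduct.induction_on with
    | zero => simp
    | tmul x y => simp
    | add x y hx hy => simp only [map_add, hx, hy]
  rw [skewRight, key, comm_comul, skewLeft]

end NCSF

theorem mainTheorem12 {m n : ℕ} (α : Composition m) (β : Composition n) :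
    NCSF.skewRight (NCSF.ribbonSchur α) (NCSF.fundamentalQSym β) =
        NCSF.skewLeft (NCSF.fundamentalQSym β) (NCSF.ribbonSchur α) ∧
    NCSF.toSeries (NCSF.skewRight (NCSF.ribbonSchur α) (NCSF.fundamentalQSym β)) =
        ∑ p ∈ NCSF.decompositions α with β ∈ NCSF.bracket n p.2, NCSF.diagramSchur p.1 ∧
    NCSF.skewRight (NCSF.ribbonSchur α) (NCSF.fundamentalQSym β) =
        ∑ p ∈ NCSF.decompositions α with β ∈ NCSF.bracket n p.2,
          ∑ γ' ∈ NCSF.bracket p.1.card p.1, NCSF.ribbonSchur γ' ∧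
    NCSF.toSeries (NCSF.skewLeft (NCSF.fundamentalQSym β) (NCSF.ribbonSchur α)) =
        ∑ p ∈ NCSF.decompositions α with β ∈ NCSF.bracket n p.1, NCSF.diagramSchur p.2 ∧
    NCSF.skewLeft (NCSF.fundamentalQSym β) (NCSF.ribbonSchur α) =
        ∑ p ∈ NCSF.decompositions α with β ∈ NCSF.bracket n p.1,
          ∑ δ' ∈ NCSF.bracket p.2.card p.2, NCSF.ribbonSchur δ' := by
  refine ⟨NCSF.skewRight_eq_skewLeft _ _, ?_, ?_, ?_, ?_⟩
  · rw [NCSF.skewRight_ribbonSchur, map_sum]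
    exact Finset.sum_congr rfl fun p hp => (NCSF.diagramSchur_eq_toSeries _
      (NCSF.isStaircase_of_mem_decompositions α (Finset.mem_filter.mp hp).1).1).symm
  · rw [NCSF.skewRight_ribbonSchur]
    exact Finset.sum_congr rfl fun p _ => (NCSF.sum_bracket_ribbonSchur p.1).symm
  · rw [NCSF.skewLeft_ribbonSchur, map_sum]
    exact Finset.sum_congr rfl fun p hp => (NCSF.diagramSchur_eq_toSeries _
      (NCSF.isStaircase_of_mem_decompositions α (Finset.mem_filter.mp hp).1).2).symm
  · rw [NCSF.skewLeft_ribbonSchur]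
    exact Finset.sum_congr rfl fun p _ => (NCSF.sum_bracket_ribbonSchur p.2).symm
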